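/- Let $\{X_{i,k};\, i,k\ge 1\}$ be an infinite array of i.i.d. real random variables, defined on one probability space, with mean $\mu=E X_{1,1}$ and variance $\operatorname{Var}(X_{1,1})>0$. Let $(p_n)_{n\ge1}$ be positive integers such that, for some constants $\tau>0$ and $0<c_1\le c_2<\infty$ not depending on $n$, $c_1\le p_n/n^{\tau}\le c_2$ for all $n\ge 1$. Put $$M_n=\max_{1\le i<j\le p_n}\Big(\sum_{k=1}^n |X_{i,k}-X_{j,k}|^2\Big)^{1/2}.$$ Assume that $E|X_{1,1}|^{8\tau+8+\epsilon}<\infty$ for some $\epsilon>0$. Then the condition $$\mathrm{Corr}\big(|X_{1,1}-X_{2,1}|^2,\;|X_{1,1}-X_{3,1}|^2\big)<\tfrac13 \qquad (*)$$ is equivalent to $E|X_{1,1}-\mu|^4<5\,(E|X_{1,1}-\mu|^2)^2$, and if $(*)$ holds, then, as $n\to\infty$, $$\frac{M_n^2-2n\,E|X_{1,1}-\mu|^2}{\sqrt{2\big(E|X_{1,1}-\mu|^4+(E|X_{1,1}-\mu|^2)^2\big)\,n\log p_n}}\;\longrightarrow\;2\qquad\text{almost surely.}$$ -/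

import Mathlib

open MeasureTheory ProbabilityTheory Filter Topology

/-- The `i`-th row, cut to its first `n` entries, of an infinite array `x` of real numbers, as a
vector of Euclidean space `ℝⁿ`. Rows and columns are numbered from `0`. -/
noncomputable def arrayRow (x : ℕ → ℕ → ℝ) (n i : ℕ) : EuclideanSpace ℝ (Fin n) :=
  WithLp.toLp 2 (fun k : Fin n => x i k)

/-- The maximum interpoint distance of the first `p` rows of the array `x`, each cut to its first
`n` entries: the maximum over `i < j` of the Euclidean distance of the rows `i` and `j`.
The supremum is over a finite set; it is a genuine maximum as soon as `2 ≤ p`. -/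
noncomputable def maxInterpointDist (x : ℕ → ℕ → ℝ) (p n : ℕ) : ℝ :=
  ⨆ q : {q : Fin p × Fin p // q.1 < q.2}, ‖arrayRow x n q.1.1 - arrayRow x n q.1.2‖

/-- The correlation coefficient of two real random variables. -/
noncomputable def corr {Ω : Type*} [MeasurableSpace Ω] (P : Measure Ω) (Y Z : Ω → ℝ) : ℝ :=
  covariance Y Z P / (Real.sqrt (variance Y P) * Real.sqrt (variance Z P))

set_option linter.unusedSectionVars false

/-! Write `m₂`, `m₄` for the central moments and let S_ij(n) be the sum over k < n of (X_ik - X_jk)²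
- 2`m₂`. The squared distance of rows i and j is 2n`m₂` + S_ij(n), so the theorem concerns the
maximum of S_ij(n) over about n^(2τ) pairs, up to constants. The summands are centred with variance
V = 2`m₄` + 2`m₂`², and at the scale √(n log n) the tail is Gaussian to polynomial precision:
P(S_ij(n) ≥ y√(n log n)) = n^(-y²/(2V) + o(1)). The maximum should therefore sit at the y with
y²/(2V) = 2τ, that is y = √(4τV). Since log p_n ~ τ log n, division by √(V n log p_n) gives 2.

Upper bound: the union bound uses Chernoff's inequality restricted to the event that all entries are
at most n^b with b < 1/4 (`measureReal_sum_ge_inter_le`, `eventually_columns_tail`). The moment of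
order 8τ + 8 + ε is what makes this truncation almost surely harmless.

Lower bound: one pair is handled by cutting the sum into about log n blocks and applying the central
limit theorem to each (`eventually_rpow_le_measureReal_sum_range_ge`). The maximum is then handled
by the second moment method on a grid of pairs (i, j), with i and j from disjoint index sets
(`measureReal_forall_notMem_le`). Only pairs sharing a row are dependent. For these S_ij + S_il has
variance 2U per term, U = 3`m₄` + `m₂`², so both exceed the level with probability at most n^(-y²/U
+ o(1)). With q the probability for one pair, the dependent pairs contribute n^(-y²/U - τ) / q².
This vanishes for every y below the critical value if 2(U - V)/U ≤ 1/2, that is if `m₄` ≤ 5`m₂`².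
The correlation in (*) equals (`m₄` - `m₂`²)/V, and it is below 1/3 exactly when `m₄` < 5`m₂`².

Almost sure statements: near the critical level the probabilities decay like small powers of n, so
Borel-Cantelli applies only along n = m^R with R large. Consecutive R-th powers have ratio tending
to 1, and a crude bound on the fluctuations of S_ij between N and n, for n - N ≤ θn, fills the gaps
(`ae_eventually_abs_sub_le`). -/

/-- Grouping an independent family indexed by pairs along the first index gives an independent
family of vectors. -/
theorem iIndepFun_curry {Ω ι κ E : Type*} [MeasurableSpace Ω] [MeasurableSpace E] {P : Measure Ω}
    {X : ι → κ → Ω → E} (mX : ∀ i k, Measurable (X i k))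
    (h : iIndepFun (fun q : ι × κ => X q.1 q.2) P) :
    iIndepFun (fun i ω k => X i k ω) P := by
  have := h.isProbabilityMeasure
  have hp : ∀ i j, IsProbabilityMeasure (P.map (X i j)) :=
    fun i j ↦ Measure.isProbabilityMeasure_map (mX i j).aemeasurable
  have h1 : iIndepFun (fun (p : (_ : ι) × κ) ω => X p.1 p.2 ω) P :=
    h.precomp (g := fun p : (_ : ι) × κ => (p.1, p.2)) (Equiv.sigmaEquivProd ι κ).injective
  have h2 : ∀ i, iIndepFun (X i) P := fun i =>
    h.precomp (g := fun k => (i, k)) (fun a b hab => by simpa using hab)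
  have hc : (MeasurableEquiv.piCurry (fun (_ : ι) (_ : κ) => E)) ∘ (fun ω p ↦ X p.1 p.2 ω)
      = fun ω i j ↦ X i j ω := by
    ext; simp [Sigma.curry]
  rw [iIndepFun_iff_map_fun_eq_infinitePi_map (by fun_prop)] at h1
  rw [iIndepFun_iff_map_fun_eq_infinitePi_map (by fun_prop), ← hc,
    ← Measure.map_map (by fun_prop) (by fun_prop), h1,
    Measure.infinitePi_map_piCurry (fun i j ↦ P.map (X i j))]
  congr with i
  rw [(iIndepFun_iff_map_fun_eq_infinitePi_map (by fun_prop)).1 (h2 i)]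

theorem exp_le_quadratic {u δ : ℝ} (h : |u| ≤ δ) (hδ : δ ≤ 1) :
    Real.exp u ≤ 1 + u + u ^ 2 / 2 * (1 + δ) := by
  have h1 := Real.exp_bound (h.trans hδ) (n := 3) (by norm_num)
  have h2 := (abs_le.1 h1).2
  simp [Finset.sum_range_succ, Nat.factorial] at h2
  have h3 : |u| ^ 3 ≤ u ^ 2 * δ := by
    rw [pow_succ, sq_abs]; gcongr
  nlinarith [sq_nonneg u, abs_nonneg u, mul_nonneg (sq_nonneg u) ((abs_nonneg u).trans h)]

/-! ### Chernoff's inequality on a truncation event. -/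

section Chernoff

variable {Ω E : Type*} [MeasurableSpace Ω] [MeasurableSpace E] {P : Measure Ω}
  [IsProbabilityMeasure P]

/-- The exponential moment of a centred variable on an event where it is bounded. -/
theorem integral_indicator_exp_le {W : Ω → ℝ} (hWm : Measurable W) (hW : MemLp W 2 P)
    (h0 : ∫ ω, W ω ∂P = 0)
    {v π M l : ℝ} (hv : ∫ ω, W ω ^ 2 ∂P ≤ v) {A : Set Ω} (hA : MeasurableSet A)
    (hM : ∀ ω ∈ A, |W ω| ≤ M) (hπ : P.real Aᶜ ≤ π) (hl : 0 ≤ l) (hlM : l * M ≤ 1) (hM0 : 0 ≤ M) :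
    Integrable (A.indicator fun ω => Real.exp (l * W ω)) P ∧
    ∫ ω, A.indicator (fun ω => Real.exp (l * W ω)) ω ∂P
      ≤ Real.exp (l * √(v * π) + l ^ 2 * v / 2 * (1 + l * M)) := by
  have hv0 : 0 ≤ v := le_trans (integral_nonneg fun ω => sq_nonneg _) hv
  have hWi : Integrable W P := hW.integrable (by norm_num)
  have hW2 : Integrable (fun ω => W ω ^ 2) P := hW.integrable_sq
  have hpt : ∀ ω, A.indicator (fun ω => Real.exp (l * W ω)) ω ≤
      1 + l * A.indicator W ω + l ^ 2 / 2 * (1 + l * M) * W ω ^ 2 := by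
    intro ω
    by_cases h : ω ∈ A
    · simp only [Set.indicator_of_mem h]
      have := exp_le_quadratic (u := l * W ω) (δ := l * M)
        (by rw [abs_mul, abs_of_nonneg hl]; exact mul_le_mul_of_nonneg_left (hM ω h) hl) hlM
      linarith [this]
    · simp only [Set.indicator_of_notMem h]
      positivity
  have hint : Integrable (A.indicator fun ω => Real.exp (l * W ω)) P := by
    refine Integrable.of_bound (C := Real.exp (l * M))
      ((Measurable.indicator (by fun_prop) hA).aestronglyMeasurable) (ae_of_all _ fun ω => ?_)
    by_cases h : ω ∈ A
    · simp only [Set.indicator_of_mem h, Real.norm_eq_abs, Real.abs_exp]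
      exact Real.exp_le_exp.2 (mul_le_mul_of_nonneg_left ((le_abs_self _).trans (hM ω h)) hl)
    · simp only [Set.indicator_of_notMem h, norm_zero]; positivity
  refine ⟨hint, ?_⟩
  -- Restricting to `A` destroys the centring. As `W` has mean zero, the bias is minus the integral
  -- over `Aᶜ`, which Cauchy-Schwarz bounds by √(vπ); no recentring is needed.
  have hcs : ∫ ω, A.indicator W ω ∂P ≤ √(v * π) := by
    have e1 : ∫ ω, A.indicator W ω ∂P = - ∫ ω, Aᶜ.indicator W ω ∂P := by
      have := integral_add_compl hA hWi
      rw [integral_indicator hA, integral_indicator hA.compl]; linarith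
    have e2 : (∫ ω, Aᶜ.indicator W ω ∂P) ^ 2 ≤ v * π := by
      set I : Ω → ℝ := Aᶜ.indicator (fun _ => (1 : ℝ)) with hI
      have hImem : MemLp I 2 P := memLp_indicator_const 2 hA.compl 1 (Or.inr (measure_ne_top _ _))
      have hIsq : ∫ ω, I ω ^ 2 ∂P = P.real Aᶜ := by
        have : (fun ω => I ω ^ 2) = Aᶜ.indicator 1 := by
          ext ω; by_cases h : ω ∈ A <;> simp [hI, h]
        rw [this, integral_indicator_one hA.compl]
      have hWI : Aᶜ.indicator W = fun ω => W ω * I ω := by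
        ext ω; by_cases h : ω ∈ A <;> simp [hI, h]
      rw [hWI]
      -- Cauchy-Schwarz through the discriminant of t ↦ E(t`W` - `I`)².
      have key : ∀ t : ℝ, 0 ≤ (∫ ω, W ω ^ 2 ∂P) * (t * t) + (-2 * ∫ ω, W ω * I ω ∂P) * t
          + ∫ ω, I ω ^ 2 ∂P := by
        intro t
        have h1 : 0 ≤ ∫ ω, (t * W ω - I ω) ^ 2 ∂P := integral_nonneg fun ω => sq_nonneg _
        have hWIi : Integrable (fun ω => W ω * I ω) P := hW.integrable_mul hImem
        have h2 : ∫ ω, (t * W ω - I ω) ^ 2 ∂P = ∫ ω, ((t * t) * W ω ^ 2 - 2 * t * (W ω * I ω)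
            + I ω ^ 2) ∂P := by congr 1; ext ω; ring
        have i1 : Integrable (fun ω => (t * t) * W ω ^ 2 - 2 * t * (W ω * I ω)) P :=
          (hW2.const_mul _).sub (hWIi.const_mul _)
        rw [h2, integral_add i1 hImem.integrable_sq,
          integral_sub (hW2.const_mul _) (hWIi.const_mul _), integral_const_mul,
          integral_const_mul] at h1
        linarith
      have hd := discrim_le_zero key
      rw [discrim, hIsq] at hd
      have : (∫ ω, W ω ^ 2 ∂P) * P.real Aᶜ ≤ v * π := by gcongr
      nlinarith
    rw [e1]
    refine Real.le_sqrt_of_sq_le ?_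
    rw [neg_sq]; exact e2
  calc _ ≤ ∫ ω, (1 + l * A.indicator W ω + l ^ 2 / 2 * (1 + l * M) * W ω ^ 2) ∂P :=
        integral_mono hint (((integrable_const _).add ((hWi.indicator hA).const_mul _)).add
          (hW2.const_mul _)) hpt
    _ = 1 + l * ∫ ω, A.indicator W ω ∂P + l ^ 2 / 2 * (1 + l * M) * ∫ ω, W ω ^ 2 ∂P := by
        have i1 : Integrable (fun ω => 1 + l * A.indicator W ω) P :=
          (integrable_const _).add ((hWi.indicator hA).const_mul _)
        rw [integral_add i1 (hW2.const_mul _), integral_add (integrable_const _) ((hWi.indicator hA).const_mul _),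
          integral_const_mul, integral_const_mul]
        simp
    _ ≤ 1 + l * √(v * π) + l ^ 2 / 2 * (1 + l * M) * v := by
        have : 0 ≤ l * M := by positivity
        gcongr
    _ = (l * √(v * π) + l ^ 2 * v / 2 * (1 + l * M)) + 1 := by ring
    _ ≤ _ := Real.add_one_le_exp _

/-- Chernoff's bound for a sum of i.i.d. centred variables on the event that the underlying
vectors stay in a set where the summands are bounded. -/
theorem measureReal_sum_ge_inter_le {C : ℕ → Ω → E} (hCm : ∀ k, Measurable (C k))
    (hC : iIndepFun C P) (hid : ∀ k, IdentDistrib (C k) (C 0) P P)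
    {f : E → ℝ} (hf : Measurable f) (hf2 : MemLp (fun ω => f (C 0 ω)) 2 P)
    (h0 : ∫ ω, f (C 0 ω) ∂P = 0) {v π M l : ℝ} (hv : ∫ ω, f (C 0 ω) ^ 2 ∂P ≤ v)
    {Q : Set E} (hQ : MeasurableSet Q) (hM : ∀ c ∈ Q, |f c| ≤ M)
    (hπ : P.real (C 0 ⁻¹' Q)ᶜ ≤ π) (hl : 0 ≤ l) (hlM : l * M ≤ 1) (hM0 : 0 ≤ M)
    (s : Finset ℕ) (t : ℝ) :
    P.real {ω | t ≤ ∑ k ∈ s, f (C k ω) ∧ ∀ k ∈ s, C k ω ∈ Q} ≤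
      Real.exp (-(l * t) + s.card * (l * √(v * π) + l ^ 2 * v / 2 * (1 + l * M))) := by
  set g : E → ℝ := Q.indicator fun c => Real.exp (l * f c) with hg
  have hgm : Measurable g := Measurable.indicator (by fun_prop) hQ
  have hg0 : ∀ c, 0 ≤ g c := fun c => Set.indicator_nonneg (fun _ _ => (Real.exp_pos _).le) c
  set φ := l * √(v * π) + l ^ 2 * v / 2 * (1 + l * M)
  obtain ⟨i0, b0⟩ := integral_indicator_exp_le (hf.comp (hCm 0)) hf2 h0 hv
    (hCm 0 hQ) (fun ω hω => hM _ hω) hπ hl hlM hM0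
  have hcomp : (C 0 ⁻¹' Q).indicator (fun ω => Real.exp (l * (f ∘ C 0) ω)) = fun ω => g (C 0 ω) := by
    ext ω
    by_cases h : C 0 ω ∈ Q <;> simp [hg, h]
  rw [hcomp] at i0 b0
  have hlint : ∀ k, ∫⁻ ω, ENNReal.ofReal (g (C k ω)) ∂P ≤ ENNReal.ofReal (Real.exp φ) := by
    intro k
    have : ∫⁻ ω, ENNReal.ofReal (g (C k ω)) ∂P = ∫⁻ ω, ENNReal.ofReal (g (C 0 ω)) ∂P :=
      ((hid k).comp (u := fun c => ENNReal.ofReal (g c)) hgm.ennreal_ofReal).lintegral_eq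
    rw [this, ← ofReal_integral_eq_lintegral_ofReal i0 (ae_of_all _ fun ω => hg0 _)]
    exact ENNReal.ofReal_le_ofReal b0
  have hprod : ∫⁻ ω, ∏ k ∈ s, ENNReal.ofReal (g (C k ω)) ∂P
      = ∏ k ∈ s, ∫⁻ ω, ENNReal.ofReal (g (C k ω)) ∂P :=
    lintegral_prod_eq_prod_lintegral_of_indepFun s _
      (hC.comp (fun _ c => ENNReal.ofReal (g c)) (fun _ => hgm.ennreal_ofReal))
      (fun k => (hgm.comp (hCm k)).ennreal_ofReal)
  have hmain : P {ω | t ≤ ∑ k ∈ s, f (C k ω) ∧ ∀ k ∈ s, C k ω ∈ Q} ≤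
      ENNReal.ofReal (Real.exp (-(l * t) + s.card * φ)) := by
    have hB : MeasurableSet {ω | t ≤ ∑ k ∈ s, f (C k ω) ∧ ∀ k ∈ s, C k ω ∈ Q} := by
      have : {ω | t ≤ ∑ k ∈ s, f (C k ω) ∧ ∀ k ∈ s, C k ω ∈ Q} =
          {ω | t ≤ ∑ k ∈ s, f (C k ω)} ∩ ⋂ k ∈ s, C k ⁻¹' Q := by ext; simp
      rw [this]
      exact (measurableSet_le measurable_const (Finset.measurable_fun_sum _ fun k _ =>
        hf.comp (hCm k))).inter (Finset.measurableSet_biInter _ fun k _ => hCm k hQ)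
    calc P {ω | t ≤ ∑ k ∈ s, f (C k ω) ∧ ∀ k ∈ s, C k ω ∈ Q}
        = ∫⁻ ω, {ω | t ≤ ∑ k ∈ s, f (C k ω) ∧ ∀ k ∈ s, C k ω ∈ Q}.indicator 1 ω ∂P := by
          rw [lintegral_indicator_one hB]
      _ ≤ ∫⁻ ω, ENNReal.ofReal (Real.exp (-(l * t))) *
            ∏ k ∈ s, ENNReal.ofReal (g (C k ω)) ∂P := by
          refine lintegral_mono fun ω => ?_
          by_cases h : ω ∈ {ω | t ≤ ∑ k ∈ s, f (C k ω) ∧ ∀ k ∈ s, C k ω ∈ Q}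
          · rw [Set.indicator_of_mem h]
            have : ∏ k ∈ s, ENNReal.ofReal (g (C k ω))
                = ENNReal.ofReal (Real.exp (l * ∑ k ∈ s, f (C k ω))) := by
              rw [Finset.mul_sum, Real.exp_sum, ENNReal.ofReal_prod_of_nonneg
                (fun _ _ => (Real.exp_pos _).le)]
              refine Finset.prod_congr rfl fun k hk => ?_
              rw [hg, Set.indicator_of_mem (h.2 k hk)]
            rw [this, ← ENNReal.ofReal_mul (Real.exp_pos _).le, ← Real.exp_add, Pi.one_apply,
              ENNReal.one_le_ofReal, Real.one_le_exp_iff]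
            have := mul_le_mul_of_nonneg_left h.1 hl
            linarith
          · rw [Set.indicator_of_notMem h]; exact zero_le
      _ = ENNReal.ofReal (Real.exp (-(l * t))) *
            ∏ k ∈ s, ∫⁻ ω, ENNReal.ofReal (g (C k ω)) ∂P := by
          rw [lintegral_const_mul _ (by fun_prop), hprod]
      _ ≤ ENNReal.ofReal (Real.exp (-(l * t))) * ∏ k ∈ s, ENNReal.ofReal (Real.exp φ) := by
          gcongr with k hk; exact hlint k
      _ = _ := by
          rw [Finset.prod_const, ← ENNReal.ofReal_pow (Real.exp_pos _).le,
            ← ENNReal.ofReal_mul (Real.exp_pos _).le, ← Real.exp_nat_mul, ← Real.exp_add]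
  exact ENNReal.toReal_le_of_le_ofReal (Real.exp_pos _).le hmain

end Chernoff

/-! ### Moderate deviation upper bounds at scale √(n log n). -/

section Chernoff

/-- Asymptotic form of the Chernoff exponent at the scale `√(n log n)`. -/
theorem eventually_chernoff_exponent_le {v K y θ η : ℝ} (hv : 0 ≤ v) (hK : 0 ≤ K)
    (hθ1 : θ ≤ 1) (hη : 0 < η) {M π : ℕ → ℝ} (hM0 : ∀ n, 0 ≤ M n)
    (hM : Tendsto (fun n : ℕ => M n * √(Real.log n / n)) atTop (𝓝 0))
    (hπ : Tendsto (fun n : ℕ => n * Real.log n * π n) atTop (𝓝 0)) :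
    ∀ᶠ n : ℕ in atTop, (K * √(Real.log n / n)) * M n ≤ 1 ∧ ∀ s : ℕ, (s : ℝ) ≤ θ * n →
      -((K * √(Real.log n / n)) * (y * √(n * Real.log n))) +
        s * ((K * √(Real.log n / n)) * √(v * π n) +
          (K * √(Real.log n / n)) ^ 2 * v / 2 * (1 + (K * √(Real.log n / n)) * M n))
      ≤ -(K * y - θ * K ^ 2 * v / 2 - η) * Real.log n := by
  have hlM : Tendsto (fun n : ℕ => (K * √(Real.log n / n)) * M n) atTop (𝓝 0) := by
    have := hM.const_mul K
    simp only [mul_zero] at this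
    exact this.congr fun n => by ring
  have hs : Tendsto (fun n : ℕ => K * √v * √(n * Real.log n * π n)) atTop (𝓝 0) := by
    have := (hπ.sqrt).const_mul (K * √v)
    simpa using this
  have hq : Tendsto (fun n : ℕ => K ^ 2 * v / 2 * ((K * √(Real.log n / n)) * M n)) atTop (𝓝 0) := by
    simpa using hlM.const_mul (K ^ 2 * v / 2)
  have hlog : ∀ᶠ n : ℕ in atTop, 1 ≤ Real.log n :=
    (Real.tendsto_log_atTop.comp tendsto_natCast_atTop_atTop).eventually_ge_atTop 1
  filter_upwards [hlM.eventually_le_const one_pos, hs.eventually_le_const (half_pos hη),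
    hq.eventually_le_const (half_pos hη), hlog, eventually_gt_atTop 0] with n h1 h2 h3 hL hn
  refine ⟨h1, fun s hsn => ?_⟩
  have hn' : (0 : ℝ) < n := by exact_mod_cast hn
  set L := Real.log n
  have hL0 : 0 ≤ L := by linarith
  set δ := (K * √(L / n)) * M n with hδ
  have hδ0 : 0 ≤ δ := mul_nonneg (mul_nonneg hK (Real.sqrt_nonneg _)) (hM0 n)
  have e1 : √(L / n) * √(n * L) = L := by
    rw [← Real.sqrt_mul (by positivity), show L / n * (n * L) = L ^ 2 by field_simp,
      Real.sqrt_sq hL0]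
  have e2 : √(L / n) ^ 2 = L / n := Real.sq_sqrt (by positivity)
  -- The accumulated bias of n truncated terms; it vanishes because n log n · `π n` does.
  have e3 : n * √(L / n) * √(v * π n) = √v * √(n * L * π n) := by
    have ea : n * √(L / n) = √(n * L) := by
      rw [show (n : ℝ) * L = n ^ 2 * (L / n) by field_simp, Real.sqrt_mul (by positivity),
        Real.sqrt_sq hn'.le]
    rw [ea, ← Real.sqrt_mul (by positivity), ← Real.sqrt_mul hv]
    congr 1; ring
  have hsn1 : (s : ℝ) ≤ n := hsn.trans (by nlinarith)
  have t1 : (s : ℝ) * ((K * √(L / n)) * √(v * π n)) ≤ η / 2 * L := by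
    calc (s : ℝ) * ((K * √(L / n)) * √(v * π n)) ≤ n * ((K * √(L / n)) * √(v * π n)) := by gcongr
      _ = K * √v * √(n * L * π n) := by linear_combination K * e3
      _ ≤ η / 2 := h2
      _ ≤ _ := by nlinarith
  have t2 : (s : ℝ) * ((K * √(L / n)) ^ 2 * v / 2 * (1 + δ))
      ≤ (θ * K ^ 2 * v / 2 + η / 2) * L := by
    rw [mul_pow, e2]
    have a1 : (s : ℝ) * (K ^ 2 * (L / n) * v / 2) ≤ θ * K ^ 2 * v / 2 * L := by
      calc (s : ℝ) * (K ^ 2 * (L / n) * v / 2) ≤ (θ * n) * (K ^ 2 * (L / n) * v / 2) := by gcongr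
        _ = _ := by field_simp
    have a2 : (s : ℝ) * (K ^ 2 * (L / n) * v / 2) * δ ≤ η / 2 * L := by
      calc (s : ℝ) * (K ^ 2 * (L / n) * v / 2) * δ ≤ n * (K ^ 2 * (L / n) * v / 2) * δ := by gcongr
        _ = K ^ 2 * v / 2 * δ * L := by field_simp
        _ ≤ _ := by gcongr
    linarith
  have t3 : (K * √(L / n)) * (y * √(n * L)) = K * y * L := by linear_combination K * y * e1
  rw [t3]
  linarith

/-- Moderate deviation upper bound, uniform over a class of i.i.d. sequences with the same
one-dimensional characteristics. -/
theorem eventually_measureReal_sum_ge_inter_le {Ω E α : Type*} [MeasurableSpace Ω]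
    [MeasurableSpace E] {P : Measure Ω} [IsProbabilityMeasure P]
    {C : α → ℕ → Ω → E} (hCm : ∀ a k, Measurable (C a k))
    (hC : ∀ a, iIndepFun (C a) P) (hid : ∀ a k, IdentDistrib (C a k) (C a 0) P P)
    {f : E → ℝ} (hf : Measurable f) (hf2 : ∀ a, MemLp (fun ω => f (C a 0 ω)) 2 P)
    (h0 : ∀ a, ∫ ω, f (C a 0 ω) ∂P = 0) {v : ℝ} (hv : ∀ a, ∫ ω, f (C a 0 ω) ^ 2 ∂P ≤ v)
    (hv0 : 0 ≤ v) {Q : ℕ → Set E} (hQ : ∀ n, MeasurableSet (Q n)) {M π : ℕ → ℝ}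
    (hQM : ∀ n, ∀ c ∈ Q n, |f c| ≤ M n) (hQπ : ∀ᶠ n in atTop, ∀ a, P.real (C a 0 ⁻¹' Q n)ᶜ ≤ π n)
    (hM0 : ∀ n, 0 ≤ M n)
    (hM : Tendsto (fun n : ℕ => M n * √(Real.log n / n)) atTop (𝓝 0))
    (hπ : Tendsto (fun n : ℕ => n * Real.log n * π n) atTop (𝓝 0))
    {K θ η : ℝ} (y : ℝ) (hK : 0 ≤ K) (hθ1 : θ ≤ 1) (hη : 0 < η) :
    ∀ᶠ n : ℕ in atTop, ∀ a, ∀ s : Finset ℕ, (s.card : ℝ) ≤ θ * n →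
      P.real {ω | y * √(n * Real.log n) ≤ ∑ k ∈ s, f (C a k ω) ∧ ∀ k ∈ s, C a k ω ∈ Q n} ≤
        (n : ℝ) ^ (-(K * y - θ * K ^ 2 * v / 2 - η)) := by
  filter_upwards [eventually_chernoff_exponent_le (y := y) hv0 hK hθ1 hη hM0 hM hπ,
    eventually_gt_atTop 0, hQπ] with n hn hn0 hQπ a s hs
  refine (measureReal_sum_ge_inter_le (hCm a) (hC a) (hid a) hf (hf2 a) (h0 a) (hv a) (hQ n)
    (hQM n) (hQπ a) (mul_nonneg hK (Real.sqrt_nonneg _)) hn.1 (hM0 n) s _).trans ?_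
  rw [Real.rpow_def_of_pos (by exact_mod_cast hn0), mul_comm (Real.log _)]
  exact Real.exp_le_exp.2 (hn.2 _ hs)

end Chernoff

/-! ### Moderate deviation lower bounds for i.i.d. sums. -/

section ModerateDeviations

variable {Ω : Type*} [MeasurableSpace Ω] {P : Measure Ω} [IsProbabilityMeasure P]

/-- Disjoint blocks are independent and the second is a shift with the same law, so tail
probabilities are supermultiplicative. This is what permits splitting a sum into blocks. -/
theorem measureReal_sum_range_add_ge {Y : ℕ → Ω → ℝ} (hm : ∀ k, Measurable (Y k))
    (hY : iIndepFun Y P) (hid : ∀ k, IdentDistrib (Y k) (Y 0) P P) (n m : ℕ) (s t : ℝ) :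
    P.real {ω | s ≤ ∑ k ∈ Finset.range n, Y k ω} * P.real {ω | t ≤ ∑ k ∈ Finset.range m, Y k ω} ≤
      P.real {ω | s + t ≤ ∑ k ∈ Finset.range (n + m), Y k ω} := by
  have hd : Disjoint (Finset.range n) (Finset.Ico n (n + m)) := by
    rw [Finset.disjoint_left]; intro a; simp; omega
  have hind := (hY.indepFun_finset _ _ hd hm).comp
    (φ := fun x : (Finset.range n → ℝ) => ∑ k, x k)
    (ψ := fun x : (Finset.Ico n (n + m) → ℝ) => ∑ k, x k) (by fun_prop) (by fun_prop)
  have e1 : P.real {ω | t ≤ ∑ k ∈ Finset.range m, Y k ω} =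
      P.real {ω | t ≤ ∑ k ∈ Finset.Ico n (n + m), Y k ω} := by
    have hpi : IdentDistrib (fun ω k => Y k ω) (fun ω k => Y (n + k) ω) P P :=
      IdentDistrib.pi (fun k => (hid k).trans (hid (n + k)).symm) hY
        (hY.precomp (g := fun k => n + k) (add_right_injective n))
    have := (hpi.comp (u := fun x : ℕ → ℝ => ∑ k ∈ Finset.range m, x k) (by fun_prop)).measure_mem_eq
      (s := Set.Ici t) measurableSet_Ici
    simp only [measureReal_def]
    congr 1
    convert this using 2
    · ext ω; simp
    · ext ω; simp [Finset.sum_Ico_eq_sum_range]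
  have e2 := hind.measure_inter_preimage_eq_mul (Set.Ici s) (Set.Ici t) measurableSet_Ici
    measurableSet_Ici
  have e3 : ∀ (S : Finset ℕ) (r : ℝ), ((fun x : (S → ℝ) => ∑ k, x k) ∘ fun ω (i : S) => Y i ω) ⁻¹'
      Set.Ici r = {ω | r ≤ ∑ k ∈ S, Y k ω} := by
    intro S r; ext ω
    simp only [Set.mem_preimage, Function.comp, Set.mem_Ici, Set.mem_ofPred_eq]
    rw [Finset.sum_coe_sort S (fun k => Y k ω)]
  rw [e3, e3] at e2
  rw [e1, measureReal_def, measureReal_def, ← ENNReal.toReal_mul, ← e2, ← measureReal_def]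
  refine measureReal_mono fun ω hω => ?_
  simp only [Set.mem_inter_iff, Set.mem_ofPred_eq] at hω ⊢
  rw [← Finset.sum_range_add_sum_Ico _ (Nat.le_add_right n m)]
  linarith [hω.1, hω.2]

theorem pow_measureReal_sum_range_ge_le {Y : ℕ → Ω → ℝ} (hm : ∀ k, Measurable (Y k))
    (hY : iIndepFun Y P) (hid : ∀ k, IdentDistrib (Y k) (Y 0) P P) (m B : ℕ) (s : ℝ) :
    P.real {ω | s ≤ ∑ k ∈ Finset.range m, Y k ω} ^ B ≤
      P.real {ω | B * s ≤ ∑ k ∈ Finset.range (m * B), Y k ω} := by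
  induction B with
  | zero => simp
  | succ B ih =>
    rw [pow_succ]
    refine (mul_le_mul_of_nonneg_right ih measureReal_nonneg).trans ?_
    refine (measureReal_sum_range_add_ge hm hY hid _ _ _ _).trans_eq ?_
    rw [Nat.mul_succ]; congr 2; ext ω; push_cast; ring_nf

/-- Lower bound for the tail of the standard Gaussian law. -/
theorem gaussianReal_Ioi_ge {a : ℝ} (ha : 0 ≤ a) :
    Real.exp (-((a + 1) ^ 2 / 2 + 1)) ≤ (gaussianReal 0 1).real (Set.Ioi a) := by
  have h1 : ENNReal.ofReal (Real.exp (-((a + 1) ^ 2 / 2 + 1))) ≤ gaussianReal 0 1 (Set.Ioi a) := by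
    calc ENNReal.ofReal (Real.exp (-((a + 1) ^ 2 / 2 + 1)))
        = ∫⁻ x in Set.Ioc a (a + 1), ENNReal.ofReal (Real.exp (-((a + 1) ^ 2 / 2 + 1))) := by simp
      _ ≤ ∫⁻ x in Set.Ioc a (a + 1), gaussianPDF 0 1 x := by
        refine setLIntegral_mono (measurable_gaussianPDF _ _) fun x hx => ?_
        rw [gaussianPDF]
        refine ENNReal.ofReal_le_ofReal ?_
        rw [gaussianPDFReal]
        simp only [NNReal.coe_one, mul_one, sub_zero]
        -- This is 2π ≤ e².
        have h2 : Real.exp (-1) ≤ (√(2 * Real.pi))⁻¹ := by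
          rw [Real.exp_neg]
          refine inv_anti₀ (by positivity) ?_
          refine Real.sqrt_le_iff.2 ⟨(Real.exp_pos _).le, ?_⟩
          have := Real.exp_one_gt_d9
          have := Real.pi_lt_d2
          nlinarith
        have h3 : -((a + 1) ^ 2 / 2) ≤ -x ^ 2 / 2 := by
          have : x ^ 2 ≤ (a + 1) ^ 2 := pow_le_pow_left₀ (ha.trans hx.1.le) hx.2 2
          linarith
        rw [show -((a + 1) ^ 2 / 2 + 1) = -1 + -((a + 1) ^ 2 / 2) by ring, Real.exp_add]
        gcongr
      _ ≤ ∫⁻ x in Set.Ioi a, gaussianPDF 0 1 x :=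
        lintegral_mono_set fun x hx => hx.1
      _ = _ := (gaussianReal_apply 0 one_ne_zero _).symm
  exact (ENNReal.ofReal_le_iff_le_toReal (measure_ne_top _ _)).1 h1

/-- Central limit theorem with the portmanteau inequality for the open set (a, ∞). The constant 2,
against 1 in `gaussianReal_Ioi_ge`, gives the strict inequality that the liminf requires. -/
theorem eventually_measureReal_sum_range_ge {Y : ℕ → Ω → ℝ}
    (hY : iIndepFun Y P) (hid : ∀ k, IdentDistrib (Y k) (Y 0) P P)
    (h0 : ∫ ω, Y 0 ω ∂P = 0) (h1 : ∫ ω, Y 0 ω ^ 2 ∂P = 1) {a : ℝ} (ha : 0 ≤ a) :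
    ∀ᶠ n : ℕ in atTop, Real.exp (-((a + 1) ^ 2 / 2 + 2)) ≤
      P.real {ω | a * √n ≤ ∑ k ∈ Finset.range n, Y k ω} := by
  have hclt := tendstoInDistribution_inv_sqrt_mul_sum (P' := gaussianReal 0 1) (Y := id)
    HasLaw.id h0 h1 hY hid
  have hlt : ENNReal.ofReal (Real.exp (-((a + 1) ^ 2 / 2 + 2))) < gaussianReal 0 1 (Set.Ioi a) := by
    rw [ENNReal.ofReal_lt_iff_lt_toReal (Real.exp_pos _).le (measure_ne_top _ _)]
    refine lt_of_lt_of_le ?_ (gaussianReal_Ioi_ge ha)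
    exact Real.exp_lt_exp.2 (by linarith)
  have hlim := ProbabilityMeasure.le_liminf_measure_open_of_tendsto hclt.tendsto
    (isOpen_Ioi (a := a))
  simp only [ProbabilityMeasure.coe_mk, Measure.map_id] at hlim
  filter_upwards [eventually_lt_of_lt_liminf (hlt.trans_le hlim), eventually_gt_atTop 0] with n hn hn0
  rw [Measure.map_apply_of_aemeasurable (hclt.forall_aemeasurable n) measurableSet_Ioi] at hn
  refine ((ENNReal.ofReal_le_iff_le_toReal (measure_ne_top _ _)).1 hn.le).trans ?_
  refine measureReal_mono fun ω hω => ?_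
  simp only [Set.mem_preimage, Set.mem_Ioi, Set.mem_ofPred_eq] at hω ⊢
  have hs : 0 < √(n : ℝ) := Real.sqrt_pos.2 (by exact_mod_cast hn0)
  rw [inv_mul_eq_div, lt_div_iff₀ hs] at hω
  exact hω.le

end ModerateDeviations

section ModerateDeviations

variable {Ω : Type*} [MeasurableSpace Ω] {P : Measure Ω} [IsProbabilityMeasure P]

/-- Chebyshev: the sum has variance r ≤ B, so it leaves the level √(2B) with probability at most
1/2. It serves for the incomplete block left after division into blocks. -/
theorem half_le_measureReal_sum_range_ge {Y : ℕ → Ω → ℝ} (hm : ∀ k, Measurable (Y k))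
    (hY : iIndepFun Y P) (hid : ∀ k, IdentDistrib (Y k) (Y 0) P P) (hL2 : MemLp (Y 0) 2 P)
    (h0 : ∫ ω, Y 0 ω ∂P = 0) (h1 : ∫ ω, Y 0 ω ^ 2 ∂P = 1) {r B : ℕ} (hB : 0 < B) (hr : r ≤ B) :
    1 / 2 ≤ P.real {ω | -√(2 * B) ≤ ∑ k ∈ Finset.range r, Y k ω} := by
  have hmem : ∀ k, MemLp (Y k) 2 P := fun k => (hid k).memLp_iff.2 hL2
  set S : Ω → ℝ := fun ω => ∑ k ∈ Finset.range r, Y k ω with hS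
  have hSm : Measurable S := by fun_prop
  have hSmem : MemLp S 2 P := memLp_finsetSum _ fun k _ => hmem k
  have hmean : ∫ ω, S ω ∂P = 0 := by
    rw [hS, integral_finsetSum _ fun k _ => (hmem k).integrable (by norm_num)]
    refine Finset.sum_eq_zero fun k _ => ?_
    rw [(hid k).integral_eq, h0]
  have hvar : variance S P = r := by
    have e : S = ∑ k ∈ Finset.range r, Y k := by ext ω; simp [hS]
    rw [e, IndepFun.variance_sum (fun k _ => hmem k)
      (fun i _ j _ hij => hY.indepFun hij)]
    have : ∀ k, variance (Y k) P = 1 := fun k => by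
      rw [(hid k).variance_eq, variance_of_integral_eq_zero (hm 0).aemeasurable h0]; exact h1
    simp [this]
  have hB' : (0 : ℝ) < B := by exact_mod_cast hB
  have hpos : 0 < √(2 * (B : ℝ)) := Real.sqrt_pos.2 (by positivity)
  have hch := meas_ge_le_variance_div_sq hSmem hpos
  rw [hmean, hvar, Real.sq_sqrt (by positivity)] at hch
  have hch' : P.real {ω | √(2 * B) ≤ |S ω - 0|} ≤ 1 / 2 := by
    refine (ENNReal.toReal_le_of_le_ofReal (by positivity) hch).trans ?_
    rw [div_le_div_iff₀ (by positivity) (by norm_num)]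
    have : (r : ℝ) ≤ B := by exact_mod_cast hr
    linarith
  have hcompl : {ω | -√(2 * B) ≤ S ω}ᶜ ⊆ {ω | √(2 * B) ≤ |S ω - 0|} := by
    intro ω hω
    simp only [Set.mem_compl_iff, Set.mem_ofPred_eq, not_le, sub_zero] at hω ⊢
    rw [abs_of_neg (by linarith)]; linarith
  have hms : MeasurableSet {ω | -√(2 * B) ≤ S ω} := measurableSet_le measurable_const hSm
  have := measureReal_mono hcompl (μ := P)
  rw [probReal_compl_eq_one_sub hms] at this
  linarith

theorem eventually_mul_log_add_le {c d e : ℝ} (he : 0 < e) :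
    ∀ᶠ n : ℕ in atTop, c * Real.log n + d ≤ e * n := by
  have h1 := (Real.isLittleO_log_id_atTop.comp_tendsto tendsto_natCast_atTop_atTop).def
    (show 0 < e / (2 * (|c| + 1)) by positivity)
  filter_upwards [h1, tendsto_natCast_atTop_atTop.eventually_ge_atTop (2 * d / e)] with n h2 h3
  simp only [Function.comp, id, Real.norm_eq_abs, Nat.abs_cast] at h2
  rw [div_le_iff₀ he] at h3
  have h4 : c * Real.log n ≤ |c| * |Real.log n| := by rw [← abs_mul]; exact le_abs_self _
  have h5 : |c| * |Real.log n| ≤ |c| * (e / (2 * (|c| + 1)) * n) := by gcongr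
  have h6 : |c| * (e / (2 * (|c| + 1)) * n) ≤ e * n / 2 := by
    rw [show |c| * (e / (2 * (|c| + 1)) * n) = (|c| / (|c| + 1)) * (e * n / 2) by field_simp]
    exact mul_le_of_le_one_left (by positivity) ((div_le_one (by positivity)).2 (by linarith))
  linarith

theorem tendsto_log_natCast_atTop : Tendsto (fun n : ℕ => Real.log n) atTop atTop :=
  Real.tendsto_log_atTop.comp tendsto_natCast_atTop_atTop

/-- Moderate deviation lower bound for standardised i.i.d. sequences. -/
theorem eventually_rpow_le_measureReal_sum_range_ge {Y : ℕ → Ω → ℝ} (hm : ∀ k, Measurable (Y k))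
    (hY : iIndepFun Y P) (hid : ∀ k, IdentDistrib (Y k) (Y 0) P P) (hL2 : MemLp (Y 0) 2 P)
    (h0 : ∫ ω, Y 0 ω ∂P = 0) (h1 : ∫ ω, Y 0 ω ^ 2 ∂P = 1) {y β : ℝ} (hy : 0 ≤ y)
    (hβ : y ^ 2 / 2 < β) :
    ∀ᶠ n : ℕ in atTop, (n : ℝ) ^ (-β) ≤
      P.real {ω | y * √(n * Real.log n) ≤ ∑ k ∈ Finset.range n, Y k ω} := by
  -- With κ² log n blocks, each costing a factor exp(-g), the total is n^(-gκ²). The expression here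
  -- is gκ² for the `a` and `g` below, and it tends to y²/2 as κ → 0.
  obtain ⟨κ, hκ, hκβ⟩ : ∃ κ : ℝ, 0 < κ ∧ (y + 2 * κ) ^ 2 / 2 + 2 * κ ^ 2 < β := by
    have ht : Tendsto (fun κ : ℝ => (y + 2 * κ) ^ 2 / 2 + 2 * κ ^ 2) (𝓝[>] 0) (𝓝 (y ^ 2 / 2)) := by
      have : Continuous (fun κ : ℝ => (y + 2 * κ) ^ 2 / 2 + 2 * κ ^ 2) := by fun_prop
      have := (this.tendsto 0).mono_left (nhdsWithin_le_nhds (s := Set.Ioi 0))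
      simpa using this
    obtain ⟨κ, h⟩ := ((ht.eventually_lt_const hβ).and self_mem_nhdsWithin).exists
    exact ⟨κ, h.2, h.1⟩
  set a := y / κ + 1 with ha
  have ha0 : 0 ≤ a := by positivity
  have haκ : a * κ = y + κ := by rw [ha]; field_simp
  set g := (a + 1) ^ 2 / 2 + 2 with hg
  have hgκ : g * κ ^ 2 < β := by
    have : g * κ ^ 2 = (a * κ + κ) ^ 2 / 2 + 2 * κ ^ 2 := by rw [hg]; ring
    rw [this, haκ]; convert hκβ using 3; ring
  have hg0 : 0 < g := by positivity
  set B : ℕ → ℕ := fun n => ⌈κ ^ 2 * Real.log n⌉₊ with hBdef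
  have hL1 := tendsto_log_natCast_atTop.eventually_ge_atTop 1
  have hBub : ∀ᶠ n : ℕ in atTop, (B n : ℝ) ≤ κ ^ 2 * Real.log n + 1 := by
    filter_upwards [hL1] with n hn
    exact (Nat.ceil_lt_add_one (by positivity)).le
  have hBpos : ∀ᶠ n : ℕ in atTop, 0 < B n := by
    filter_upwards [hL1] with n hn
    exact Nat.ceil_pos.2 (by positivity)
  have hℓ : Tendsto (fun n => n / B n) atTop atTop := by
    refine tendsto_atTop.2 fun b => ?_
    filter_upwards [hBub, hBpos, eventually_mul_log_add_le (c := b * κ ^ 2) (d := b) one_pos]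
      with n h1 h2 h3
    rw [Nat.le_div_iff_mul_le h2]
    have : (b : ℝ) * B n ≤ n := by
      have : (b : ℝ) * B n ≤ b * (κ ^ 2 * Real.log n + 1) := by gcongr
      linarith
    exact_mod_cast this
  -- The blocks aim at y + κ. The factor c < 1 pays for the part of n not covered by full blocks and
  -- still leaves κ/2 for the incomplete block.
  set c := (y + κ / 2) / (y + κ) with hc
  have hc0 : 0 < c := by positivity
  have hc1 : c < 1 := by rw [hc, div_lt_one (by positivity)]; linarith
  have hc2 : 0 < 1 - c ^ 2 := by nlinarith
  -- Slack for rounding the number of blocks up (g) and for the factor 1/2 of the incomplete block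
  -- (log 2).
  have hlast : ∀ᶠ n : ℕ in atTop, g + Real.log 2 ≤ (β - g * κ ^ 2) * Real.log n := by
    have := tendsto_log_natCast_atTop.const_mul_atTop (sub_pos.2 hgκ)
    exact this.eventually_ge_atTop _
  filter_upwards [hL1, hBub, hBpos, hlast, eventually_ge_atTop 16,
    hℓ.eventually (eventually_measureReal_sum_range_ge hY hid h0 h1 ha0),
    tendsto_log_natCast_atTop.eventually_ge_atTop (1 / κ ^ 2),
    eventually_mul_log_add_le (c := κ ^ 2) (d := 1) hc2] with n hL hBu hBp hl hn16 hclt hLκ hBn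
  set L := Real.log n with hLdef
  set b := B n with hb
  set ℓ := n / b with hℓdef
  set r := n % b with hrdef
  have hn0 : (0 : ℝ) < n := by exact_mod_cast (by omega : 0 < n)
  have hn16' : (16 : ℝ) ≤ n := by exact_mod_cast hn16
  have hnr : ℓ * b + r = n := by rw [mul_comm]; exact Nat.div_add_mod n b
  have hrb : r ≤ b := (Nat.mod_lt _ hBp).le
  have hbL : κ ^ 2 * L ≤ b := Nat.le_ceil _
  have hb2 : (b : ℝ) ≤ 2 * κ ^ 2 * L := by
    have : 1 ≤ κ ^ 2 * L := by
      rw [div_le_iff₀ (by positivity)] at hLκ; linarith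
    linarith
  have hprob : Real.exp (-(g * b)) * (1 / 2) ≤
      P.real {ω | b * (a * √ℓ) + -√(2 * b) ≤ ∑ k ∈ Finset.range n, Y k ω} := by
    calc Real.exp (-(g * b)) * (1 / 2) ≤
        P.real {ω | a * √ℓ ≤ ∑ k ∈ Finset.range ℓ, Y k ω} ^ b *
          P.real {ω | -√(2 * b) ≤ ∑ k ∈ Finset.range r, Y k ω} := by
          gcongr
          · rw [show -(g * b) = b * -g by ring, Real.exp_nat_mul]
            gcongr
          · exact half_le_measureReal_sum_range_ge hm hY hid hL2 h0 h1 hBp hrb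
      _ ≤ P.real {ω | b * (a * √ℓ) ≤ ∑ k ∈ Finset.range (ℓ * b), Y k ω} *
          P.real {ω | -√(2 * b) ≤ ∑ k ∈ Finset.range r, Y k ω} := by
          gcongr; exact pow_measureReal_sum_range_ge_le hm hY hid _ _ _
      _ ≤ _ := by
          have := measureReal_sum_range_add_ge hm hY hid (ℓ * b) r (b * (a * √ℓ)) (-√(2 * b))
          rwa [hnr] at this
  have hthr : y * √(n * L) ≤ b * (a * √ℓ) + -√(2 * b) := by
    have s1 : √(2 * b) ≤ κ / 2 * √(n * L) := by
      refine Real.sqrt_le_iff.2 ⟨by positivity, ?_⟩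
      rw [mul_pow, Real.sq_sqrt (by positivity)]
      have : 16 * (κ ^ 2 * L) ≤ n * (κ ^ 2 * L) := by gcongr
      nlinarith
    have s2 : c * √n * (κ * √L) ≤ b * √ℓ := by
      have e1 : (b : ℝ) * √ℓ = √(ℓ * b) * √b := by
        rw [Real.sqrt_mul (by positivity), mul_assoc, Real.mul_self_sqrt (by positivity), mul_comm]
      have e2 : c * √n ≤ √(ℓ * b) := by
        refine Real.le_sqrt_of_sq_le ?_
        rw [mul_pow, Real.sq_sqrt hn0.le]
        have q1 : (ℓ : ℝ) * b + r = n := by exact_mod_cast hnr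
        have q2 : (r : ℝ) ≤ b := by exact_mod_cast hrb
        nlinarith
      have e3 : κ * √L ≤ √b := by
        refine Real.le_sqrt_of_sq_le ?_
        rw [mul_pow, Real.sq_sqrt (by linarith)]; exact hbL
      rw [e1]; gcongr
    have s3 : a * (c * √n * (κ * √L)) = (y + κ / 2) * √(n * L) := by
      rw [Real.sqrt_mul hn0.le, show a * (c * √n * (κ * √L)) = (a * κ) * c * (√n * √L) by ring, haκ,
        hc]
      field_simp
    have s4 := mul_le_mul_of_nonneg_left s2 ha0
    rw [s3] at s4
    linarith
  have hfin : (n : ℝ) ^ (-β) ≤ Real.exp (-(g * b)) * (1 / 2) := by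
    rw [Real.rpow_def_of_pos hn0, show (1 / 2 : ℝ) = Real.exp (-Real.log 2) by
      rw [Real.exp_neg, Real.exp_log (by norm_num)]; norm_num, ← Real.exp_add]
    refine Real.exp_le_exp.2 ?_
    have : g * b ≤ g * (κ ^ 2 * L + 1) := by gcongr
    linarith
  refine hfin.trans (hprob.trans (measureReal_mono fun ω hω => ?_))
  exact hthr.trans hω

/-- Moderate deviation lower bound for centred i.i.d. sequences of variance `v`. -/
theorem eventually_rpow_le_measureReal_sum_range_ge_of_variance {Y : ℕ → Ω → ℝ}
    (hm : ∀ k, Measurable (Y k))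
    (hY : iIndepFun Y P) (hid : ∀ k, IdentDistrib (Y k) (Y 0) P P) (hL2 : MemLp (Y 0) 2 P)
    (h0 : ∫ ω, Y 0 ω ∂P = 0) {v : ℝ} (hv : 0 < v) (h1 : ∫ ω, Y 0 ω ^ 2 ∂P = v) {y β : ℝ}
    (hy : 0 ≤ y) (hβ : y ^ 2 / (2 * v) < β) :
    ∀ᶠ n : ℕ in atTop, (n : ℝ) ^ (-β) ≤
      P.real {ω | y * √(n * Real.log n) ≤ ∑ k ∈ Finset.range n, Y k ω} := by
  have hs : 0 < √v := Real.sqrt_pos.2 hv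
  have hg : Measurable (fun x : ℝ => x / √v) := by fun_prop
  have := eventually_rpow_le_measureReal_sum_range_ge (Y := fun k ω => Y k ω / √v) (P := P)
    (fun k => (hm k).div_const _) (hY.comp (fun _ x => x / √v) fun _ => hg)
    (fun k => (hid k).comp hg) (by simpa [div_eq_inv_mul] using hL2.const_mul (√v)⁻¹)
    (by rw [integral_div, h0, zero_div])
    (by simp only [div_pow]; rw [integral_div, h1, Real.sq_sqrt hv.le, div_self hv.ne'])
    (y := y / √v) (β := β) (by positivity) (by
      rw [div_pow, Real.sq_sqrt hv.le, div_div, mul_comm v]; exact hβ)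
  filter_upwards [this] with n hn
  refine hn.trans (measureReal_mono fun ω hω => ?_)
  simp only [Set.mem_ofPred_eq, ← Finset.sum_div] at hω ⊢
  rw [div_mul_eq_mul_div] at hω
  exact (div_le_div_iff_of_pos_right hs).1 hω

end ModerateDeviations

/-! ### The second moment method on a grid. -/

section SecondMoment

variable {Ω ι κ : Type*} [MeasurableSpace Ω] {P : Measure Ω} [IsProbabilityMeasure P]
  [DecidableEq ι] [DecidableEq κ]

/-- Second moment method for events indexed by a grid, where events in distinct rows and
columns are independent. -/
theorem measureReal_forall_notMem_le {s : Finset ι} {t : Finset κ} {E : ι → κ → Set Ω}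
    (hE : ∀ i j, MeasurableSet (E i j)) {m : ℕ} (hm : 0 < m) (hs : s.card = m) (ht : t.card = m)
    {q r : ℝ} (hq0 : 0 < q) (hr0 : 0 ≤ r) (hq : ∀ i ∈ s, ∀ j ∈ t, q ≤ P.real (E i j))
    (hr1 : ∀ i ∈ s, ∀ j ∈ t, ∀ j' ∈ t, j ≠ j' → P.real (E i j ∩ E i j') ≤ r)
    (hr2 : ∀ i ∈ s, ∀ i' ∈ s, ∀ j ∈ t, i ≠ i' → P.real (E i j ∩ E i' j) ≤ r)
    (hind : ∀ i ∈ s, ∀ i' ∈ s, ∀ j ∈ t, ∀ j' ∈ t, i ≠ i' → j ≠ j' →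
      P.real (E i j ∩ E i' j') = P.real (E i j) * P.real (E i' j')) :
    P.real {ω | ∀ i ∈ s, ∀ j ∈ t, ω ∉ E i j} ≤ 1 / (m ^ 2 * q) + 2 * r / (m * q ^ 2) := by
  set I : ι × κ → Ω → ℝ := fun a => (E a.1 a.2).indicator fun _ => 1 with hI
  have hImem : ∀ a, MemLp (I a) 2 P := fun a =>
    memLp_indicator_const 2 (hE _ _) 1 (Or.inr (measure_ne_top _ _))
  have hIint : ∀ a, ∫ ω, I a ω ∂P = P.real (E a.1 a.2) := fun a => integral_indicator_one (hE _ _)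
  set N : Ω → ℝ := fun ω => ∑ a ∈ s ×ˢ t, I a ω with hN
  have hNmem : MemLp N 2 P := memLp_finsetSum _ fun a _ => hImem a
  set e := ∑ a ∈ s ×ˢ t, P.real (E a.1 a.2) with he
  have hmean : ∫ ω, N ω ∂P = e := by
    rw [hN, integral_finsetSum _ fun a _ => (hImem a).integrable (by norm_num)]
    exact Finset.sum_congr rfl fun a _ => hIint a
  have hcov : ∀ a b, covariance (I a) (I b) P =
      P.real (E a.1 a.2 ∩ E b.1 b.2) - P.real (E a.1 a.2) * P.real (E b.1 b.2) := by
    intro a b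
    rw [covariance_eq_sub (hImem a) (hImem b), hIint, hIint]
    congr 1
    rw [← integral_indicator_one ((hE _ _).inter (hE _ _))]
    congr 1; ext ω
    by_cases h1 : ω ∈ E a.1 a.2 <;> by_cases h2 : ω ∈ E b.1 b.2 <;> simp [hI, h1, h2]
  have hm' : (0 : ℝ) < m := by exact_mod_cast hm
  have he_ge : m ^ 2 * q ≤ e := by
    have : (s ×ˢ t).card • q ≤ e := Finset.card_nsmul_le_sum _ _ _ fun a ha => by
      rw [Finset.mem_product] at ha; exact hq _ ha.1 _ ha.2
    rw [Finset.card_product, hs, ht] at this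
    simpa [pow_two] using this
  have he0 : 0 < e := lt_of_lt_of_le (by positivity) he_ge
  -- The diagonal contributes at most e. Each of the m² cells meets fewer than 2m others in its row
  -- or column, each with covariance at most r; all remaining covariances vanish.
  have hvar : variance N P ≤ e + 2 * m ^ 3 * r := by
    have e1 : variance N P = ∑ a ∈ s ×ˢ t, ∑ b ∈ s ×ˢ t, covariance (I a) (I b) P :=
      variance_fun_sum' fun a _ => hImem a
    rw [e1]
    have hbd : ∀ a ∈ s ×ˢ t, ∑ b ∈ s ×ˢ t, covariance (I a) (I b) P ≤
        P.real (E a.1 a.2) + 2 * m * r := by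
      rintro ⟨i, j⟩ ha
      rw [Finset.mem_product] at ha
      have hterm : ∀ b ∈ s ×ˢ t, covariance (I (i, j)) (I b) P ≤
          (if (i, j) = b then P.real (E i j) else 0) + (if b.1 = i then r else 0)
            + (if b.2 = j then r else 0) := by
        rintro ⟨i', j'⟩ hb
        rw [Finset.mem_product] at hb
        simp only at ha hb
        rw [hcov]
        have hp : 0 ≤ P.real (E i j) * P.real (E i' j') :=
          mul_nonneg measureReal_nonneg measureReal_nonneg
        by_cases h1 : i = i'
        · subst h1
          by_cases h2 : j = j'
          · subst h2
            simp only [Set.inter_self, if_true]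
            linarith
          · have := hr1 i ha.1 j ha.2 j' hb.2 h2
            simp [h2, Ne.symm h2]
            linarith
        · by_cases h2 : j = j'
          · subst h2
            have := hr2 i ha.1 i' hb.1 j ha.2 h1
            simp [h1, Ne.symm h1]
            linarith
          · simp only
            rw [hind i ha.1 i' hb.1 j ha.2 j' hb.2 h1 h2]
            simp [h1, h2, Ne.symm h1, Ne.symm h2]
      refine (Finset.sum_le_sum hterm).trans ?_
      rw [Finset.sum_add_distrib, Finset.sum_add_distrib, Finset.sum_ite_eq, Finset.sum_product,
        Finset.sum_product]
      have k1 : ∑ x ∈ s, ∑ y ∈ t, (if x = i then r else 0) = m * r := by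
        simp [ht, Finset.sum_ite_eq', ha.1]
      have k2 : ∑ x ∈ s, ∑ y ∈ t, (if y = j then r else 0) = m * r := by
        simp [hs, Finset.sum_ite_eq', ha.2]
      simp only [k1, k2, Finset.mem_product, ha, and_self, if_true]
      linarith
    refine (Finset.sum_le_sum hbd).trans_eq ?_
    rw [Finset.sum_add_distrib, Finset.sum_const, Finset.card_product, hs, ht, nsmul_eq_mul]
    push_cast; ring
  have hch := meas_ge_le_variance_div_sq hNmem he0
  rw [hmean] at hch
  have hch' := ENNReal.toReal_le_of_le_ofReal (by have := variance_nonneg N P; positivity) hch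
  have hsub : {ω | ∀ i ∈ s, ∀ j ∈ t, ω ∉ E i j} ⊆ {ω | e ≤ |N ω - e|} := by
    intro ω hω
    have : N ω = 0 := Finset.sum_eq_zero fun a ha => by
      rw [Finset.mem_product] at ha
      simp [hI, hω _ ha.1 _ ha.2]
    simp [this, abs_of_pos he0]
  refine (measureReal_mono hsub).trans (hch'.trans ?_)
  calc variance N P / e ^ 2 ≤ (e + 2 * m ^ 3 * r) / e ^ 2 := by gcongr
    _ = 1 / e + 2 * m ^ 3 * r / e ^ 2 := by field_simp
    _ ≤ 1 / (m ^ 2 * q) + 2 * m ^ 3 * r / (m ^ 2 * q) ^ 2 := by gcongr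
    _ = _ := by congr 1; field_simp

end SecondMoment

/-! ### Moments of squared differences of independent variables. -/

section Moments

variable {Ω : Type*} [MeasurableSpace Ω] {P : Measure Ω} [IsProbabilityMeasure P]

theorem IndepFun.integrable_and_integral_mul {f g : Ω → ℝ} (h : IndepFun f g P)
    (hf : Integrable f P) (hg : Integrable g P) :
    Integrable (fun ω => f ω * g ω) P ∧
      ∫ ω, f ω * g ω ∂P = (∫ ω, f ω ∂P) * ∫ ω, g ω ∂P :=
  ⟨h.integrable_mul hf hg, h.integral_fun_mul_eq_mul_integral hf.1 hg.1⟩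

/-- A centred random variable with second moment `m₂` and fourth moment `m₄`. -/
structure HasCentralMoments (U : Ω → ℝ) (P : Measure Ω) (m₂ m₄ : ℝ) : Prop where
  meas : Measurable U
  int4 : Integrable (fun ω => U ω ^ 4) P
  mean : ∫ ω, U ω ∂P = 0
  second : ∫ ω, U ω ^ 2 ∂P = m₂
  fourth : ∫ ω, U ω ^ 4 ∂P = m₄

namespace HasCentralMoments

variable {U V W : Ω → ℝ} {m₂ m₄ : ℝ}

theorem integrable_pow (hU : HasCentralMoments U P m₂ m₄) {k : ℕ} (hk : k ≤ 4) :
    Integrable (fun ω => U ω ^ k) P := by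
  have := hU.meas
  refine Integrable.mono' ((integrable_const 1).add hU.int4)
    (by fun_prop) (ae_of_all _ fun ω => ?_)
  rw [Real.norm_eq_abs, abs_pow]
  simp only [Pi.add_apply]
  have h4 : U ω ^ 4 = |U ω| ^ 4 := (Even.pow_abs (by decide) _).symm
  rw [h4]
  rcases le_total |U ω| 1 with h | h
  · have := pow_le_one₀ (n := k) (abs_nonneg _) h
    have : 0 ≤ |U ω| ^ 4 := by positivity
    linarith
  · have := pow_le_pow_right₀ h hk
    linarith

theorem integrable (hU : HasCentralMoments U P m₂ m₄) : Integrable U P := by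
  simpa using hU.integrable_pow (k := 1) (by norm_num)

/-- The centred squared distance of two independent variables. -/
theorem sq_sub (hU : HasCentralMoments U P m₂ m₄) (hV : HasCentralMoments V P m₂ m₄)
    (h : IndepFun U V P) :
    MemLp (fun ω => (U ω - V ω) ^ 2 - 2 * m₂) 2 P ∧
      ∫ ω, ((U ω - V ω) ^ 2 - 2 * m₂) ∂P = 0 ∧
      ∫ ω, ((U ω - V ω) ^ 2 - 2 * m₂) ^ 2 ∂P = 2 * m₄ + 2 * m₂ ^ 2 := by
  have hUm := hU.meas
  have hVm := hV.meas
  have key : ∀ i j : ℕ, i ≤ 4 → j ≤ 4 → Integrable (fun ω => U ω ^ i * V ω ^ j) P ∧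
      ∫ ω, U ω ^ i * V ω ^ j ∂P = (∫ ω, U ω ^ i ∂P) * ∫ ω, V ω ^ j ∂P := fun i j hi hj =>
    IndepFun.integrable_and_integral_mul
      (h.comp (φ := fun x => x ^ i) (ψ := fun x => x ^ j) (by fun_prop) (by fun_prop))
      (hU.integrable_pow hi) (hV.integrable_pow hj)
  have k11 := key 1 1 (by norm_num) (by norm_num)
  have k22 := key 2 2 (by norm_num) (by norm_num)
  have k31 := key 3 1 (by norm_num) (by norm_num)
  have k13 := key 1 3 (by norm_num) (by norm_num)
  simp only [pow_one, hU.mean, hV.mean, hU.second, hV.second, zero_mul, mul_zero] at k11 k22 k31 k13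
  have u2 := hU.integrable_pow (k := 2) (by norm_num)
  have v2 := hV.integrable_pow (k := 2) (by norm_num)
  have u4 := hU.int4
  have v4 := hV.int4
  have e1 : (fun ω => (U ω - V ω) ^ 2 - 2 * m₂) =
      fun ω => (U ω ^ 2 + V ω ^ 2) + (-2) * (U ω * V ω) + (-2 * m₂) := by ext; ring
  have e2 : (fun ω => ((U ω - V ω) ^ 2 - 2 * m₂) ^ 2) =
      fun ω => (U ω ^ 4 + V ω ^ 4) + ((-4) * (U ω ^ 3 * V ω) + (-4) * (U ω * V ω ^ 3)) +
        6 * (U ω ^ 2 * V ω ^ 2) + ((-4 * m₂) * (U ω ^ 2) + (-4 * m₂) * (V ω ^ 2)) +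
        (8 * m₂) * (U ω * V ω) + 4 * m₂ ^ 2 := by ext; ring
  have a1 : Integrable (fun ω => U ω ^ 2 + V ω ^ 2) P := u2.add v2
  have a2 : Integrable (fun ω => (-2) * (U ω * V ω)) P := k11.1.const_mul _
  have a3 : Integrable (fun ω => (U ω ^ 2 + V ω ^ 2) + (-2) * (U ω * V ω)) P := a1.add a2
  have b1 : Integrable (fun ω => U ω ^ 4 + V ω ^ 4) P := u4.add v4
  have b2 : Integrable (fun ω => (-4) * (U ω ^ 3 * V ω) + (-4) * (U ω * V ω ^ 3)) P :=
    (k31.1.const_mul _).add (k13.1.const_mul _)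
  have b3 : Integrable (fun ω => (-4 * m₂) * (U ω ^ 2) + (-4 * m₂) * (V ω ^ 2)) P :=
    (u2.const_mul _).add (v2.const_mul _)
  have c1 : Integrable (fun ω => (U ω ^ 4 + V ω ^ 4) + ((-4) * (U ω ^ 3 * V ω) +
      (-4) * (U ω * V ω ^ 3))) P := b1.add b2
  have c2 : Integrable (fun ω => (U ω ^ 4 + V ω ^ 4) + ((-4) * (U ω ^ 3 * V ω) +
      (-4) * (U ω * V ω ^ 3)) + 6 * (U ω ^ 2 * V ω ^ 2)) P := c1.add (k22.1.const_mul _)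
  have c3 : Integrable (fun ω => (U ω ^ 4 + V ω ^ 4) + ((-4) * (U ω ^ 3 * V ω) +
      (-4) * (U ω * V ω ^ 3)) + 6 * (U ω ^ 2 * V ω ^ 2) +
      ((-4 * m₂) * (U ω ^ 2) + (-4 * m₂) * (V ω ^ 2))) P := c2.add b3
  have c4 : Integrable (fun ω => (U ω ^ 4 + V ω ^ 4) + ((-4) * (U ω ^ 3 * V ω) +
      (-4) * (U ω * V ω ^ 3)) + 6 * (U ω ^ 2 * V ω ^ 2) +
      ((-4 * m₂) * (U ω ^ 2) + (-4 * m₂) * (V ω ^ 2)) + (8 * m₂) * (U ω * V ω)) P :=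
    c3.add (k11.1.const_mul _)
  refine ⟨?_, ?_, ?_⟩
  · rw [memLp_two_iff_integrable_sq (by fun_prop), e2]
    exact c4.add (integrable_const _)
  · rw [e1, integral_add a3 (integrable_const _), integral_add a1 a2, integral_add u2 v2,
      integral_const_mul, k11.2, hU.second, hV.second]
    simp; ring
  · rw [e2, integral_add c4 (integrable_const _), integral_add c3 (k11.1.const_mul _),
      integral_add c2 b3, integral_add c1 (k22.1.const_mul _), integral_add b1 b2,
      integral_add u4 v4, integral_add (k31.1.const_mul _) (k13.1.const_mul _),
      integral_add (u2.const_mul _) (v2.const_mul _)]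
    simp only [integral_const_mul, k11.2, k22.2, k31.2, k13.2, hU.second, hV.second, hU.fourth,
      hV.fourth]
    simp; ring

/-- The covariance of the squared distances of one variable to two others. -/
theorem integral_sq_sub_mul_sq_sub (hU : HasCentralMoments U P m₂ m₄)
    (hV : HasCentralMoments V P m₂ m₄) (hW : HasCentralMoments W P m₂ m₄)
    (hUW : IndepFun U W P) (hV_UW : IndepFun V (fun ω => (U ω, W ω)) P) :
    ∫ ω, ((U ω - V ω) ^ 2 - 2 * m₂) * ((U ω - W ω) ^ 2 - 2 * m₂) ∂P = m₄ - m₂ ^ 2 := by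
  have hUm := hU.meas
  have hVm := hV.meas
  have hWm := hW.meas
  have key : ∀ i j : ℕ, i ≤ 4 → j ≤ 4 → Integrable (fun ω => U ω ^ i * W ω ^ j) P ∧
      ∫ ω, U ω ^ i * W ω ^ j ∂P = (∫ ω, U ω ^ i ∂P) * ∫ ω, W ω ^ j ∂P := fun i j hi hj =>
    IndepFun.integrable_and_integral_mul
      (hUW.comp (φ := fun x => x ^ i) (ψ := fun x => x ^ j) (by fun_prop) (by fun_prop))
      (hU.integrable_pow hi) (hW.integrable_pow hj)
  have k11 := key 1 1 (by norm_num) (by norm_num)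
  have k12 := key 1 2 (by norm_num) (by norm_num)
  have k21 := key 2 1 (by norm_num) (by norm_num)
  have k22 := key 2 2 (by norm_num) (by norm_num)
  have k31 := key 3 1 (by norm_num) (by norm_num)
  simp only [pow_one, hU.mean, hW.mean, hU.second, hW.second, zero_mul, mul_zero] at k11 k22 k31 k12 k21
  have u1 := hU.integrable
  have u2 := hU.integrable_pow (k := 2) (by norm_num)
  have u3 := hU.integrable_pow (k := 3) (by norm_num)
  have w2 := hW.integrable_pow (k := 2) (by norm_num)
  have v2 := hV.integrable_pow (k := 2) (by norm_num)
  have hD : Integrable (fun ω => (U ω - W ω) ^ 2 - 2 * m₂) P :=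
    (hU.sq_sub hW hUW).1.integrable (by norm_num)
  have hUD : Integrable (fun ω => U ω * ((U ω - W ω) ^ 2 - 2 * m₂)) P := by
    have : (fun ω => U ω * ((U ω - W ω) ^ 2 - 2 * m₂)) = fun ω =>
        U ω ^ 3 + (-2) * (U ω ^ 2 * W ω) + U ω * W ω ^ 2 + (-2 * m₂) * U ω := by ext; ring
    rw [this]
    exact ((u3.add (k21.1.const_mul _)).add k12.1).add (u1.const_mul _)
  have v2' : Integrable (fun ω => V ω ^ 2 - m₂) P := v2.sub (integrable_const _)
  have i1 := IndepFun.integrable_and_integral_mul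
    (hV_UW.comp (φ := fun x => x ^ 2 - m₂) (ψ := fun z : ℝ × ℝ => (z.1 - z.2) ^ 2 - 2 * m₂)
      (by fun_prop) (by fun_prop)) v2' hD
  have i2 := IndepFun.integrable_and_integral_mul
    (hV_UW.comp (φ := fun x => x) (ψ := fun z : ℝ × ℝ => z.1 * ((z.1 - z.2) ^ 2 - 2 * m₂))
      (by fun_prop) (by fun_prop)) hV.integrable hUD
  simp only [Function.comp_apply] at i1 i2
  rw [integral_sub v2 (integrable_const _), hV.second] at i1
  rw [hV.mean] at i2
  simp at i1 i2
  -- Expanded in powers of `V`, which is independent of (`U`, `W`): the terms carrying V² - `m₂` and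
  -- V integrate to zero, so only a polynomial in `U` and `W` is left.
  have e : (fun ω => ((U ω - V ω) ^ 2 - 2 * m₂) * ((U ω - W ω) ^ 2 - 2 * m₂)) = fun ω =>
      (V ω ^ 2 - m₂) * ((U ω - W ω) ^ 2 - 2 * m₂) +
        (-2) * (V ω * (U ω * ((U ω - W ω) ^ 2 - 2 * m₂))) + (U ω ^ 4 +
        (-2) * (U ω ^ 3 * W ω) + U ω ^ 2 * W ω ^ 2 + (-3 * m₂) * U ω ^ 2 +
        (2 * m₂) * (U ω * W ω) + (-m₂) * W ω ^ 2 + 2 * m₂ ^ 2) := by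
    ext; ring
  have c1 : Integrable (fun ω => (V ω ^ 2 - m₂) * ((U ω - W ω) ^ 2 - 2 * m₂) +
        (-2) * (V ω * (U ω * ((U ω - W ω) ^ 2 - 2 * m₂)))) P := i1.1.add (i2.1.const_mul _)
  have d1 : Integrable (fun ω => U ω ^ 4 + (-2) * (U ω ^ 3 * W ω)) P :=
    hU.int4.add (k31.1.const_mul _)
  have d2 : Integrable (fun ω => U ω ^ 4 + (-2) * (U ω ^ 3 * W ω) + U ω ^ 2 * W ω ^ 2) P :=
    d1.add k22.1
  have d3 : Integrable (fun ω => U ω ^ 4 + (-2) * (U ω ^ 3 * W ω) + U ω ^ 2 * W ω ^ 2 +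
      (-3 * m₂) * U ω ^ 2) P := d2.add (u2.const_mul _)
  have d4 : Integrable (fun ω => U ω ^ 4 + (-2) * (U ω ^ 3 * W ω) + U ω ^ 2 * W ω ^ 2 +
      (-3 * m₂) * U ω ^ 2 + (2 * m₂) * (U ω * W ω)) P := d3.add (k11.1.const_mul _)
  have d5 : Integrable (fun ω => U ω ^ 4 + (-2) * (U ω ^ 3 * W ω) + U ω ^ 2 * W ω ^ 2 +
      (-3 * m₂) * U ω ^ 2 + (2 * m₂) * (U ω * W ω) + (-m₂) * W ω ^ 2) P :=
    d4.add (w2.const_mul _)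
  have d6 : Integrable (fun ω => U ω ^ 4 + (-2) * (U ω ^ 3 * W ω) + U ω ^ 2 * W ω ^ 2 +
      (-3 * m₂) * U ω ^ 2 + (2 * m₂) * (U ω * W ω) + (-m₂) * W ω ^ 2 + 2 * m₂ ^ 2) P :=
    d5.add (integrable_const _)
  rw [e, integral_add c1 d6, integral_add i1.1 (i2.1.const_mul _),
    integral_add d5 (integrable_const _), integral_add d4 (w2.const_mul _),
    integral_add d3 (k11.1.const_mul _), integral_add d2 (u2.const_mul _), integral_add d1 k22.1,
    integral_add hU.int4 (k31.1.const_mul _)]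
  simp only [integral_const_mul, k11.2, k22.2, k31.2, i1.2, i2.2, hU.second, hW.second, hU.fourth]
  simp; ring

end HasCentralMoments

end Moments

/-! ### I.i.d. arrays: independence, laws and correlations of squared distances. -/

section Array

variable {Ω : Type*} [MeasurableSpace Ω]

/-- An i.i.d. array of real random variables with mean `μ` and central moments `m₂`, `m₄`. -/
structure IsIIDArray (P : Measure Ω) (X : ℕ → ℕ → Ω → ℝ) (μ m₂ m₄ : ℝ) : Prop where
  meas : ∀ i k, Measurable (X i k)
  indep : iIndepFun (fun q : ℕ × ℕ => X q.1 q.2) P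
  ident : ∀ i k, IdentDistrib (X i k) (X 0 0) P P
  moments : HasCentralMoments (fun ω => X 0 0 ω - μ) P m₂ m₄

namespace IsIIDArray

variable {P : Measure Ω} [IsProbabilityMeasure P] {X : ℕ → ℕ → Ω → ℝ} {μ m₂ m₄ : ℝ}

theorem moments' (h : IsIIDArray P X μ m₂ m₄) (i k : ℕ) :
    HasCentralMoments (fun ω => X i k ω - μ) P m₂ m₄ := by
  have hp : ∀ j : ℕ, IdentDistrib (fun ω => (X i k ω - μ) ^ j) (fun ω => (X 0 0 ω - μ) ^ j) P P :=
    fun j => (h.ident i k).comp (u := fun x => (x - μ) ^ j) (by fun_prop)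
  refine ⟨(h.meas i k).sub_const _, (hp 4).integrable_iff.2 h.moments.int4, ?_, ?_, ?_⟩
  · simpa [h.moments.mean] using (hp 1).integral_eq
  · rw [(hp 2).integral_eq, h.moments.second]
  · rw [(hp 4).integral_eq, h.moments.fourth]

theorem iIndepFun_rows (h : IsIIDArray P X μ m₂ m₄) : iIndepFun (fun i ω k => X i k ω) P :=
  iIndepFun_curry h.meas h.indep

theorem iIndepFun_columns (h : IsIIDArray P X μ m₂ m₄) {d : ℕ} {r : Fin d → ℕ}
    (hr : Function.Injective r) : iIndepFun (fun k ω a => X (r a) k ω) P :=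
  iIndepFun_curry (X := fun k a => X (r a) k) (fun _ _ => h.meas _ _)
    (h.indep.precomp (g := fun q : ℕ × Fin d => (r q.2, q.1)) (by
      rintro ⟨k, a⟩ ⟨k', a'⟩ he
      simp only [Prod.mk.injEq] at he
      rw [hr he.1, he.2]))

theorem identDistrib_columns (h : IsIIDArray P X μ m₂ m₄) {d : ℕ} {r : Fin d → ℕ}
    (hr : Function.Injective r) (k k' : ℕ) :
    IdentDistrib (fun ω a => X (r a) k ω) (fun ω a => X (r a) k' ω) P P :=
  have hi : ∀ k, iIndepFun (fun a => X (r a) k) P := fun k =>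
    h.indep.precomp (g := fun a : Fin d => (r a, k)) (fun a b he => hr (by simpa using he))
  IdentDistrib.pi (fun a => (h.ident (r a) k).trans (h.ident (r a) k').symm) (hi k) (hi k')

theorem identDistrib_rows (h : IsIIDArray P X μ m₂ m₄) (i j : ℕ) :
    IdentDistrib (fun ω k => X i k ω) (fun ω k => X j k ω) P P :=
  have hi : ∀ i, iIndepFun (fun k => X i k) P := fun i =>
    h.indep.precomp (g := fun k : ℕ => (i, k)) (fun a b he => by simpa using he)
  IdentDistrib.pi (fun k => (h.ident i k).trans (h.ident j k).symm) (hi i) (hi j)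

theorem indepFun_entries (h : IsIIDArray P X μ m₂ m₄) {i j : ℕ} (hij : i ≠ j) (k : ℕ) :
    IndepFun (fun ω => X i k ω - μ) (fun ω => X j k ω - μ) P :=
  (h.indep.indepFun (i := (i, k)) (j := (j, k)) (by simpa using hij)).comp
    (φ := fun x => x - μ) (ψ := fun x => x - μ) (by fun_prop) (by fun_prop)

theorem indepFun_entry_pair (h : IsIIDArray P X μ m₂ m₄) {i j l : ℕ} (hij : i ≠ j) (hjl : j ≠ l)
    (k : ℕ) :
    IndepFun (fun ω => X j k ω - μ) (fun ω => (X i k ω - μ, X l k ω - μ)) P :=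
  ((h.indep.indepFun_prodMk (fun q => h.meas _ _) (i, k) (l, k) (j, k)
    (by simpa using hij) (by simpa using hjl.symm)).symm).comp
    (φ := fun x => x - μ) (ψ := fun z : ℝ × ℝ => (z.1 - μ, z.2 - μ)) (by fun_prop) (by fun_prop)

theorem sq_sub (h : IsIIDArray P X μ m₂ m₄) {i j : ℕ} (hij : i ≠ j) (k : ℕ) :
    MemLp (fun ω => (X i k ω - X j k ω) ^ 2 - 2 * m₂) 2 P ∧
      ∫ ω, ((X i k ω - X j k ω) ^ 2 - 2 * m₂) ∂P = 0 ∧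
      ∫ ω, ((X i k ω - X j k ω) ^ 2 - 2 * m₂) ^ 2 ∂P = 2 * m₄ + 2 * m₂ ^ 2 := by
  simpa using (h.moments' i k).sq_sub (h.moments' j k) (h.indepFun_entries hij k)

theorem integral_sq_sub_mul_sq_sub (h : IsIIDArray P X μ m₂ m₄) {i j l : ℕ} (hij : i ≠ j)
    (hil : i ≠ l) (hjl : j ≠ l) (k : ℕ) :
    ∫ ω, ((X i k ω - X j k ω) ^ 2 - 2 * m₂) * ((X i k ω - X l k ω) ^ 2 - 2 * m₂) ∂P
      = m₄ - m₂ ^ 2 := by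
  simpa using (h.moments' i k).integral_sq_sub_mul_sq_sub (h.moments' j k) (h.moments' l k)
    (h.indepFun_entries hil k) (h.indepFun_entry_pair hij hjl k)

theorem corr_sq_sub (h : IsIIDArray P X μ m₂ m₄) :
    corr P (fun ω => |X 0 0 ω - X 1 0 ω| ^ 2) (fun ω => |X 0 0 ω - X 2 0 ω| ^ 2) =
      (m₄ - m₂ ^ 2) / (2 * m₄ + 2 * m₂ ^ 2) := by
  have hm := h.meas
  have hi : ∀ j, 0 ≠ j → ∫ ω, (X 0 0 ω - X j 0 ω) ^ 2 ∂P = 2 * m₂ := by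
    intro j hj
    have h1 := (h.sq_sub hj 0).2.1
    have h2 : Integrable (fun ω => (X 0 0 ω - X j 0 ω) ^ 2) P := by
      have := ((h.sq_sub hj 0).1.integrable (by norm_num)).add (integrable_const (2 * m₂))
      refine this.congr (ae_of_all _ fun ω => ?_)
      simp
    rw [integral_sub h2 (integrable_const _)] at h1
    simp at h1; linarith
  have hv : ∀ j, 0 ≠ j → variance (fun ω => (X 0 0 ω - X j 0 ω) ^ 2) P = 2 * m₄ + 2 * m₂ ^ 2 := by
    intro j hj
    rw [variance_eq_integral (by fun_prop), hi j hj, (h.sq_sub hj 0).2.2]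
  have hc : covariance (fun ω => (X 0 0 ω - X 1 0 ω) ^ 2) (fun ω => (X 0 0 ω - X 2 0 ω) ^ 2) P
      = m₄ - m₂ ^ 2 := by
    rw [covariance, hi 1 (by norm_num), hi 2 (by norm_num),
      h.integral_sq_sub_mul_sq_sub (by norm_num) (by norm_num) (by norm_num)]
  have h4 : 0 ≤ m₄ := by
    rw [← h.moments.fourth]; exact integral_nonneg fun ω => by positivity
  simp only [corr, sq_abs]
  rw [hc, hv 1 (by norm_num), hv 2 (by norm_num), Real.mul_self_sqrt (by positivity)]

end IsIIDArray

end Array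

/-! ### Limits needed for the truncation level. -/

section Asymptotics

theorem tendsto_log_div_rpow_natCast {s : ℝ} (hs : 0 < s) :
    Tendsto (fun n : ℕ => Real.log n / (n : ℝ) ^ s) atTop (𝓝 0) :=
  (isLittleO_log_rpow_atTop hs).tendsto_div_nhds_zero.comp tendsto_natCast_atTop_atTop

/-- Squared distances of entries at most n^b are of order n^(2b), and the Chernoff parameter is of
order √(log n / n). Their product vanishes because 2b < 1/2. -/
theorem tendsto_rpow_mul_sqrt_log_div {b : ℝ} (hb : b < 1 / 4) (A B : ℝ) :
    Tendsto (fun n : ℕ => (A * ((n : ℝ) ^ b) ^ 2 + B) * √(Real.log n / n)) atTop (𝓝 0) := by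
  have h1 : Tendsto (fun n : ℕ => √(Real.log n / (n : ℝ) ^ (1 - 4 * b))) atTop (𝓝 0) := by
    simpa using (tendsto_log_div_rpow_natCast (s := 1 - 4 * b) (by linarith)).sqrt
  have h2 : Tendsto (fun n : ℕ => √(Real.log n / n)) atTop (𝓝 0) := by
    simpa using (tendsto_log_div_rpow_natCast one_pos).sqrt
  have h3 := (h1.const_mul A).add (h2.const_mul B)
  simp only [mul_zero, add_zero] at h3
  refine h3.congr' ?_
  filter_upwards [eventually_gt_atTop 0] with n hn
  have hn' : (0 : ℝ) < n := by exact_mod_cast hn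
  have e : √(Real.log n / (n : ℝ) ^ (1 - 4 * b)) = ((n : ℝ) ^ b) ^ 2 * √(Real.log n / n) := by
    have e1 : Real.log n / (n : ℝ) ^ (1 - 4 * b) = (((n : ℝ) ^ b) ^ 2) ^ 2 * (Real.log n / n) := by
      rw [← pow_mul, ← Real.rpow_natCast, ← Real.rpow_mul hn'.le, Real.rpow_sub hn', Real.rpow_one]
      rw [show b * ((2 * 2 : ℕ) : ℝ) = 4 * b by push_cast; ring]
      have := (Real.rpow_pos_of_pos hn' (4 * b)).ne'
      field_simp
    rw [e1, Real.sqrt_mul (by positivity), Real.sqrt_sq (by positivity)]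
  rw [e]; ring

theorem tendsto_mul_log_mul_rpow {t : ℝ} (ht : 1 < t) (D : ℝ) :
    Tendsto (fun n : ℕ => n * Real.log n * (D * (n : ℝ) ^ (-t))) atTop (𝓝 0) := by
  have h := (tendsto_log_div_rpow_natCast (s := t - 1) (by linarith)).const_mul D
  simp only [mul_zero] at h
  refine h.congr' ?_
  filter_upwards [eventually_gt_atTop 0] with n hn
  have hn' : (0 : ℝ) < n := by exact_mod_cast hn
  rw [Real.rpow_neg hn'.le, Real.rpow_sub hn', Real.rpow_one]
  have := (Real.rpow_pos_of_pos hn' t).ne'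
  field_simp

end Asymptotics

/-! ### Borel-Cantelli and union bounds. -/

section BorelCantelli

variable {Ω : Type*} [MeasurableSpace Ω] {P : Measure Ω} [IsProbabilityMeasure P]

theorem ae_eventually_notMem_of_le_rpow {B : ℕ → Set Ω} {c t : ℝ} (ht : 1 < t)
    (h : ∀ᶠ n : ℕ in atTop, P.real (B n) ≤ c * (n : ℝ) ^ (-t)) :
    ∀ᵐ ω ∂P, ∀ᶠ n in atTop, ω ∉ B n := by
  have hs : Summable fun n => P.real (B n) := by
    refine Summable.of_norm_bounded_eventually_nat
      ((Real.summable_nat_rpow.2 (by linarith : -t < -1)).mul_left c) ?_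
    filter_upwards [h] with n hn
    rwa [Real.norm_eq_abs, abs_of_nonneg measureReal_nonneg]
  refine ae_eventually_notMem ?_
  have := hs.tsum_ofReal_ne_top
  simpa [ofReal_measureReal] using this

theorem measureReal_biUnion_le_card_mul {ι : Type*} (s : Finset ι) {B : ι → Set Ω} {x : ℝ}
    (h : ∀ i ∈ s, P.real (B i) ≤ x) : P.real (⋃ i ∈ s, B i) ≤ s.card * x := by
  refine (measureReal_biUnion_finset_le s B).trans ?_
  rw [← nsmul_eq_mul]
  exact Finset.sum_le_card_nsmul _ _ _ h

end BorelCantelli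

/-! ### Truncation and tail bounds uniform over pairs and triples of rows. -/

section Array

variable {Ω : Type*} [MeasurableSpace Ω]

/-- The centred squared distance of the rows `i` and `j`, cut to their first `n` entries. -/
def centeredSqDist (X : ℕ → ℕ → Ω → ℝ) (m₂ : ℝ) (i j n : ℕ) (ω : Ω) : ℝ :=
  ∑ k ∈ Finset.range n, ((X i k ω - X j k ω) ^ 2 - 2 * m₂)

/-- The truncation at level `n ^ b` of the entries of the array has small probability. -/
structure HasTailBound (P : Measure Ω) (X : ℕ → ℕ → Ω → ℝ) (b τ D : ℝ) : Prop where
  lt : b < 1 / 4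
  pos : 0 < τ
  nonneg : 0 ≤ D
  le : ∀ i k n : ℕ, 0 < n → P.real {ω | (n : ℝ) ^ b < |X i k ω|} ≤ D * (n : ℝ) ^ (-(2 * τ + 2))

namespace IsIIDArray

variable {P : Measure Ω} [IsProbabilityMeasure P] {X : ℕ → ℕ → Ω → ℝ} {μ m₂ m₄ b τ D : ℝ}

/-- Markov's inequality at order 8τ + 8 + ε. The exponent b is chosen to give the tail n^(-(2τ+2)),
and ε > 0 is exactly what puts it below 1/4. -/
theorem hasTailBound (h : IsIIDArray P X μ m₂ m₄) {ε : ℝ} (hτ : 0 < τ) (hε : 0 < ε)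
    (hmom : Integrable (fun ω => |X 0 0 ω| ^ (8 * τ + 8 + ε)) P) :
    HasTailBound P X ((2 * τ + 2) / (8 * τ + 8 + ε)) τ (∫ ω, |X 0 0 ω| ^ (8 * τ + 8 + ε) ∂P) := by
  set p := 8 * τ + 8 + ε with hp
  have hp0 : 0 < p := by positivity
  refine ⟨?_, hτ, integral_nonneg fun ω => by positivity, fun i k n hn => ?_⟩
  · rw [div_lt_div_iff₀ hp0 (by norm_num)]; linarith
  have hn' : (0 : ℝ) < n := by exact_mod_cast hn
  have hid : IdentDistrib (fun ω => |X i k ω| ^ p) (fun ω => |X 0 0 ω| ^ p) P P :=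
    (h.ident i k).comp (u := fun x => |x| ^ p) (by fun_prop)
  have hmk := mul_meas_ge_le_integral_of_nonneg (μ := P) (f := fun ω => |X i k ω| ^ p)
    (ae_of_all _ fun ω => by positivity) (hid.integrable_iff.2 hmom) ((n : ℝ) ^ (2 * τ + 2))
  rw [hid.integral_eq] at hmk
  have hpos : 0 < (n : ℝ) ^ (2 * τ + 2) := Real.rpow_pos_of_pos hn' _
  have hsub : {ω | (n : ℝ) ^ ((2 * τ + 2) / p) < |X i k ω|} ⊆
      {ω | (n : ℝ) ^ (2 * τ + 2) ≤ |X i k ω| ^ p} := by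
    intro ω hω
    have h1 := Real.rpow_le_rpow (by positivity) (le_of_lt hω) hp0.le
    rw [← Real.rpow_mul hn'.le, div_mul_cancel₀ _ hp0.ne'] at h1
    exact h1
  refine (measureReal_mono hsub).trans ?_
  rw [Real.rpow_neg hn'.le, ← div_eq_mul_inv, le_div_iff₀ hpos, mul_comm]
  exact hmk

/-- The columns of finitely many chosen rows are i.i.d. vectors, so the general Chernoff bound
applies, uniformly in the choice `a` of rows. It is used with d = 2 for one pair and d = 3 for two
pairs sharing a row; the growth of `f` at most quadratic matches b < 1/4. -/
theorem eventually_columns_tail (h : IsIIDArray P X μ m₂ m₄) (ht : HasTailBound P X b τ D)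
    {d : ℕ} {α : Type*} {r : α → Fin d → ℕ} (hr : ∀ a, Function.Injective (r a))
    {f : (Fin d → ℝ) → ℝ} (hf : Measurable f)
    (hf2 : ∀ a, MemLp (fun ω => f (fun c => X (r a c) 0 ω)) 2 P)
    (h0 : ∀ a, ∫ ω, f (fun c => X (r a c) 0 ω) ∂P = 0) {v : ℝ}
    (hv : ∀ a, ∫ ω, f (fun c => X (r a c) 0 ω) ^ 2 ∂P = v) (hv0 : 0 ≤ v) {A B : ℝ} (hA : 0 ≤ A)
    (hB : 0 ≤ B)
    (hfAB : ∀ T : ℝ, ∀ x : Fin d → ℝ, (∀ c, |x c| ≤ T) → |f x| ≤ A * T ^ 2 + B)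
    {K θ η : ℝ} (y : ℝ) (hK : 0 ≤ K) (hθ : θ ≤ 1) (hη : 0 < η) :
    ∀ᶠ n : ℕ in atTop, ∀ a, ∀ s : Finset ℕ, (s.card : ℝ) ≤ θ * n →
      P.real {ω | y * √(n * Real.log n) ≤ ∑ k ∈ s, f (fun c => X (r a c) k ω) ∧
          ∀ k ∈ s, ∀ c, |X (r a c) k ω| ≤ (n : ℝ) ^ b} ≤
        (n : ℝ) ^ (-(K * y - θ * K ^ 2 * v / 2 - η)) := by
  have hm := h.meas
  have htD := ht.nonneg
  have hQm : ∀ n : ℕ, MeasurableSet {x : Fin d → ℝ | ∀ c, |x c| ≤ (n : ℝ) ^ b} := by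
    intro n
    have : {x : Fin d → ℝ | ∀ c, |x c| ≤ (n : ℝ) ^ b} = ⋂ c, {x | |x c| ≤ (n : ℝ) ^ b} := by
      ext; simp
    rw [this]
    exact MeasurableSet.iInter fun c => measurableSet_le (by fun_prop) measurable_const
  refine eventually_measureReal_sum_ge_inter_le (C := fun a k ω c => X (r a c) k ω)
    (Q := fun n : ℕ => {x : Fin d → ℝ | ∀ c, |x c| ≤ (n : ℝ) ^ b})
    (M := fun n : ℕ => A * ((n : ℝ) ^ b) ^ 2 + B)
    (π := fun n : ℕ => (d * D) * (n : ℝ) ^ (-(2 * τ + 2)))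
    (fun a k => by fun_prop) (fun a => h.iIndepFun_columns (hr a))
    (fun a k => h.identDistrib_columns (hr a) k 0) hf hf2 h0 (fun a => (hv a).le) hv0 hQm
    (fun n c hc => hfAB _ c hc) ?_ (fun n => by positivity)
    (tendsto_rpow_mul_sqrt_log_div ht.lt A B)
    (tendsto_mul_log_mul_rpow (by linarith [ht.pos]) _) y hK hθ hη
  filter_upwards [eventually_gt_atTop 0] with n hn a
  have hsub : ((fun ω c => X (r a c) 0 ω) ⁻¹' {x : Fin d → ℝ | ∀ c, |x c| ≤ (n : ℝ) ^ b})ᶜ ⊆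
      ⋃ c ∈ (Finset.univ : Finset (Fin d)), {ω | (n : ℝ) ^ b < |X (r a c) 0 ω|} := by
    intro ω hω
    simpa using hω
  refine (measureReal_mono hsub (measure_ne_top _ _)).trans ((measureReal_biUnion_le_card_mul _
    fun c _ => ht.le (r a c) 0 n hn).trans_eq ?_)
  simp; ring

theorem nonneg_m₂ (h : IsIIDArray P X μ m₂ m₄) : 0 ≤ m₂ := by
  rw [← h.moments.second]; exact integral_nonneg fun ω => by positivity

theorem nonneg_m₄ (h : IsIIDArray P X μ m₂ m₄) : 0 ≤ m₄ := by
  rw [← h.moments.fourth]; exact integral_nonneg fun ω => by positivity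

theorem abs_sq_sub_le {x y T m : ℝ} (hx : |x| ≤ T) (hy : |y| ≤ T) (hm : 0 ≤ m) :
    |(x - y) ^ 2 - 2 * m| ≤ 4 * T ^ 2 + 2 * m := by
  have h1 : |x - y| ≤ 2 * T := (abs_sub x y).trans (by linarith)
  have h2 : (x - y) ^ 2 ≤ (2 * T) ^ 2 := sq_le_sq' (by linarith [neg_abs_le (x - y)])
    ((le_abs_self _).trans h1)
  rw [abs_le]; constructor <;> nlinarith [sq_nonneg (x - y)]

/-- Tail bound for (signed) partial sums of the centred squared distance of two rows. -/
theorem eventually_pair_tail (h : IsIIDArray P X μ m₂ m₄) (ht : HasTailBound P X b τ D)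
    {σ : ℝ} (hσ : |σ| = 1) {K θ η : ℝ} (y : ℝ) (hK : 0 ≤ K) (hθ : θ ≤ 1) (hη : 0 < η) :
    ∀ᶠ n : ℕ in atTop, ∀ i j : ℕ, i ≠ j → ∀ s : Finset ℕ, (s.card : ℝ) ≤ θ * n →
      P.real {ω | y * √(n * Real.log n) ≤ σ * ∑ k ∈ s, ((X i k ω - X j k ω) ^ 2 - 2 * m₂) ∧
          ∀ k ∈ s, |X i k ω| ≤ (n : ℝ) ^ b ∧ |X j k ω| ≤ (n : ℝ) ^ b} ≤
        (n : ℝ) ^ (-(K * y - θ * K ^ 2 * (2 * m₄ + 2 * m₂ ^ 2) / 2 - η)) := by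
  have hσ2 : σ ^ 2 = 1 := by rw [← sq_abs, hσ, one_pow]
  have h2 := h.nonneg_m₂
  have h4 := h.nonneg_m₄
  have := h.eventually_columns_tail ht (α := {a : ℕ × ℕ // a.1 ≠ a.2}) (d := 2)
    (r := fun a => ![a.1.1, a.1.2])
    (fun a => by
      intro c c' hc
      fin_cases c <;> fin_cases c' <;> simp_all [a.2, a.2.symm])
    (f := fun x => σ * ((x 0 - x 1) ^ 2 - 2 * m₂)) (by fun_prop)
    (fun a => by simpa using (h.sq_sub a.2 0).1.const_mul σ)
    (fun a => by simp only [integral_const_mul]; simp [(h.sq_sub a.2 0).2.1])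
    (v := 2 * m₄ + 2 * m₂ ^ 2)
    (fun a => by
      simp only [mul_pow, hσ2, one_mul]
      simpa using (h.sq_sub a.2 0).2.2)
    (by positivity) (A := 4) (B := 2 * m₂) (by norm_num) (by positivity)
    (fun T x hx => by
      rw [abs_mul, hσ, one_mul]; exact abs_sq_sub_le (hx 0) (hx 1) h2) y hK hθ hη
  filter_upwards [this] with n hn i j hij s hs
  refine le_trans (measureReal_mono fun ω hω => ?_) (hn ⟨(i, j), hij⟩ s hs)
  refine ⟨?_, fun k hk c => ?_⟩
  · have := hω.1
    rw [Finset.mul_sum] at this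
    exact this
  · fin_cases c
    · exact (hω.2 k hk).1
    · exact (hω.2 k hk).2

/-- Joint tail bound for the centred squared distances of one row to two others. -/
theorem eventually_triple_tail (h : IsIIDArray P X μ m₂ m₄) (ht : HasTailBound P X b τ D)
    {y η : ℝ} (hy : 0 ≤ y) (hη : 0 < η) (hV : 0 < 3 * m₄ + m₂ ^ 2) :
    ∀ᶠ n : ℕ in atTop, ∀ i j l : ℕ, i ≠ j → i ≠ l → j ≠ l →
      P.real {ω | y * √(n * Real.log n) ≤ centeredSqDist X m₂ i j n ω ∧
          y * √(n * Real.log n) ≤ centeredSqDist X m₂ i l n ω ∧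
          ∀ k < n, |X i k ω| ≤ (n : ℝ) ^ b ∧ |X j k ω| ≤ (n : ℝ) ^ b ∧ |X l k ω| ≤ (n : ℝ) ^ b} ≤
        (n : ℝ) ^ (-(y ^ 2 / (3 * m₄ + m₂ ^ 2) - η)) := by
  have h2 := h.nonneg_m₂
  have h4 := h.nonneg_m₄
  have hm := h.meas
  have hsum : ∀ i j l : ℕ, i ≠ j → i ≠ l → j ≠ l →
      ∫ ω, ((X i 0 ω - X j 0 ω) ^ 2 - 2 * m₂ + ((X i 0 ω - X l 0 ω) ^ 2 - 2 * m₂)) ^ 2 ∂P =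
        2 * (3 * m₄ + m₂ ^ 2) := by
    intro i j l hij hil hjl
    obtain ⟨a1, -, a3⟩ := h.sq_sub hij 0
    obtain ⟨b1, -, b3⟩ := h.sq_sub hil 0
    have c := h.integral_sq_sub_mul_sq_sub hij hil hjl 0
    have e : (fun ω => ((X i 0 ω - X j 0 ω) ^ 2 - 2 * m₂ + ((X i 0 ω - X l 0 ω) ^ 2 - 2 * m₂)) ^ 2)
        = fun ω => ((X i 0 ω - X j 0 ω) ^ 2 - 2 * m₂) ^ 2 +
          ((X i 0 ω - X l 0 ω) ^ 2 - 2 * m₂) ^ 2 +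
          2 * (((X i 0 ω - X j 0 ω) ^ 2 - 2 * m₂) * ((X i 0 ω - X l 0 ω) ^ 2 - 2 * m₂)) := by
      ext; ring
    have i1 : Integrable (fun ω => ((X i 0 ω - X j 0 ω) ^ 2 - 2 * m₂) ^ 2 +
        ((X i 0 ω - X l 0 ω) ^ 2 - 2 * m₂) ^ 2) P := a1.integrable_sq.add b1.integrable_sq
    have i2 : Integrable (fun ω => ((X i 0 ω - X j 0 ω) ^ 2 - 2 * m₂) *
        ((X i 0 ω - X l 0 ω) ^ 2 - 2 * m₂)) P := a1.integrable_mul b1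
    rw [e, integral_add i1 (i2.const_mul _), integral_add a1.integrable_sq b1.integrable_sq,
      integral_const_mul, a3, b3, c]
    ring
  have := h.eventually_columns_tail ht
    (α := {a : ℕ × ℕ × ℕ // a.1 ≠ a.2.1 ∧ a.1 ≠ a.2.2 ∧ a.2.1 ≠ a.2.2}) (d := 3)
    (r := fun a => ![a.1.1, a.1.2.1, a.1.2.2])
    (fun a => by
      obtain ⟨⟨i, j, l⟩, hij, hil, hjl⟩ := a
      simp only at hij hil hjl
      intro c c' hc
      fin_cases c <;> fin_cases c' <;> simp_all [hij.symm, hil.symm, hjl.symm])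
    (f := fun x => (x 0 - x 1) ^ 2 - 2 * m₂ + ((x 0 - x 2) ^ 2 - 2 * m₂)) (by fun_prop)
    (fun a => (h.sq_sub a.2.1 0).1.add (h.sq_sub a.2.2.1 0).1)
    (fun a => by
      have i1 := (h.sq_sub a.2.1 0).1.integrable (by norm_num)
      have i2 := (h.sq_sub a.2.2.1 0).1.integrable (by norm_num)
      have := integral_add i1 i2
      rw [(h.sq_sub a.2.1 0).2.1, (h.sq_sub a.2.2.1 0).2.1, add_zero] at this
      simpa using this)
    (v := 2 * (3 * m₄ + m₂ ^ 2))
    (fun a => by simpa using hsum _ _ _ a.2.1 a.2.2.1 a.2.2.2)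
    (by positivity) (A := 8) (B := 4 * m₂) (by norm_num) (by positivity)
    (fun T x hx => by
      have e1 := abs_sq_sub_le (hx 0) (hx 1) h2
      have e2 := abs_sq_sub_le (hx 0) (hx 2) h2
      exact (abs_add_le _ _).trans (by linarith))
    -- The sum of both distances exceeds level 2y and has variance 2U per term, U = 3`m₄` + `m₂`².
    -- The optimal K = y/U yields the exponent 2yK - K²U = y²/U.
    (K := y / (3 * m₄ + m₂ ^ 2)) (θ := 1) (2 * y) (by positivity) le_rfl hη
  filter_upwards [this] with n hn i j l hij hil hjl
  refine (le_trans (measureReal_mono fun ω hω => ?_)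
    (hn ⟨(i, j, l), hij, hil, hjl⟩ (Finset.range n) (by simp))).trans_eq ?_
  · refine ⟨?_, fun k hk c => ?_⟩
    · have := add_le_add hω.1 hω.2.1
      simp only [centeredSqDist, ← Finset.sum_add_distrib] at this
      simpa [two_mul, add_mul] using this
    · have := hω.2.2 k (Finset.mem_range.1 hk)
      fin_cases c
      · exact this.1
      · exact this.2.1
      · exact this.2.2
  · congr 1
    field_simp
    ring

end IsIIDArray

end Array

/-! ### Almost sure truncation, small fluctuations, and the upper bound along R-th powers. -/

section Array

theorem natCeil_mul_rpow_le {c τ : ℝ} (hc : 0 ≤ c) (hτ : 0 ≤ τ) {n : ℕ} (hn : 0 < n) :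
    (⌈c * (n : ℝ) ^ τ⌉₊ : ℝ) ≤ (c + 1) * (n : ℝ) ^ τ := by
  have h1 : (1 : ℝ) ≤ (n : ℝ) ^ τ := Real.one_le_rpow (by exact_mod_cast hn) hτ
  have h2 := (Nat.ceil_lt_add_one (show 0 ≤ c * (n : ℝ) ^ τ by positivity)).le
  linarith

theorem natCast_pow_rpow (m R : ℕ) (t : ℝ) : ((m ^ R : ℕ) : ℝ) ^ t = (m : ℝ) ^ (R * t) := by
  rw [Nat.cast_pow, Real.rpow_mul (Nat.cast_nonneg m), Real.rpow_natCast]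

variable {Ω : Type*} [MeasurableSpace Ω]

namespace IsIIDArray

variable {P : Measure Ω} [IsProbabilityMeasure P] {X : ℕ → ℕ → Ω → ℝ} {μ m₂ m₄ b τ D : ℝ}

/-- Almost surely, no entry of a polynomially large block exceeds the truncation level. -/
theorem ae_eventually_abs_le (ht : HasTailBound P X b τ D) {c : ℝ} (hc : 0 ≤ c) :
    ∀ᵐ ω ∂P, ∀ᶠ n : ℕ in atTop, ∀ i : ℕ, (i : ℝ) < c * (n : ℝ) ^ τ → ∀ k < n,
      |X i k ω| ≤ (n : ℝ) ^ b := by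
  have hbd : ∀ᶠ n : ℕ in atTop,
      P.real (⋃ q ∈ Finset.range ⌈c * (n : ℝ) ^ τ⌉₊ ×ˢ Finset.range n,
        {ω | (n : ℝ) ^ b < |X q.1 q.2 ω|}) ≤ ((c + 1) * D) * (n : ℝ) ^ (-(τ + 1)) := by
    filter_upwards [eventually_gt_atTop 0] with n hn
    have hn' : (0 : ℝ) < n := by exact_mod_cast hn
    refine (measureReal_biUnion_le_card_mul _ fun q _ => ht.le q.1 q.2 n hn).trans ?_
    have htD := ht.nonneg
    rw [Finset.card_product, Finset.card_range, Finset.card_range, Nat.cast_mul]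
    calc (⌈c * (n : ℝ) ^ τ⌉₊ : ℝ) * n * (D * (n : ℝ) ^ (-(2 * τ + 2)))
        ≤ (c + 1) * (n : ℝ) ^ τ * n * (D * (n : ℝ) ^ (-(2 * τ + 2))) := by
          gcongr; exact natCeil_mul_rpow_le hc ht.pos.le hn
      _ = ((c + 1) * D) * ((n : ℝ) ^ τ * (n : ℝ) ^ (1 : ℝ) * (n : ℝ) ^ (-(2 * τ + 2))) := by
          rw [Real.rpow_one]; ring
      _ = _ := by
          rw [← Real.rpow_add hn', ← Real.rpow_add hn']; congr 2; ring
  filter_upwards [ae_eventually_notMem_of_le_rpow (by linarith [ht.pos]) hbd] with ω hω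
  filter_upwards [hω] with n hn i hi k hk
  by_contra! hlt
  exact hn (Set.mem_biUnion (x := (i, k)) (by simp [Nat.lt_ceil, hi, hk]) hlt)

/-- Almost surely, the centred squared distances fluctuate little over short time intervals. -/
theorem ae_eventually_abs_sub_le (h : IsIIDArray P X μ m₂ m₄) (ht : HasTailBound P X b τ D)
    {c δ : ℝ} (hc : 0 ≤ c) (hδ : 0 < δ) :
    ∃ θ : ℝ, 0 < θ ∧ ∀ᵐ ω ∂P, ∀ᶠ n : ℕ in atTop, ∀ i j : ℕ, i ≠ j → (i : ℝ) < c * (n : ℝ) ^ τ →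
      (j : ℝ) < c * (n : ℝ) ^ τ → ∀ N ≤ n, ((n - N : ℕ) : ℝ) ≤ θ * n →
      |centeredSqDist X m₂ i j n ω - centeredSqDist X m₂ i j N ω| ≤ δ * √(n * Real.log n) := by
  have hτ := ht.pos
  set V := 2 * m₄ + 2 * m₂ ^ 2 with hV
  have hV0 : 0 ≤ V := by have := h.nonneg_m₄; positivity
  -- Kδ = 2τ + 6, less 1 for the variance term (by the choice of θ) and 1 for η, leaves the exponent
  -- 2τ + 4. The union over two rows and N < n costs 2τ + 1, so n^(-3) remains, summable over all n.
  set K := (2 * τ + 6) / δ with hK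
  have hK0 : 0 < K := by positivity
  set θ := min 1 (2 / (K ^ 2 * (V + 1))) with hθdef
  have hθ : 0 < θ := by positivity
  have hθV : θ * K ^ 2 * V / 2 ≤ 1 := by
    have h1 : θ * (K ^ 2 * (V + 1)) ≤ 2 := by
      rw [← le_div_iff₀ (by positivity)]; exact min_le_right _ _
    nlinarith [mul_pos hθ (pow_pos hK0 2)]
  refine ⟨θ, hθ, ?_⟩
  set E : ℝ → ℕ → ℕ × ℕ × ℕ → Set Ω := fun σ n q =>
    {ω | δ * √(n * Real.log n) ≤ σ * ∑ k ∈ Finset.Ico q.2.2 n,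
        ((X q.1 k ω - X q.2.1 k ω) ^ 2 - 2 * m₂) ∧
      (∀ k ∈ Finset.Ico q.2.2 n, |X q.1 k ω| ≤ (n : ℝ) ^ b ∧ |X q.2.1 k ω| ≤ (n : ℝ) ^ b) ∧
      -- The side conditions belong to the event, so it is empty for irrelevant indices and the
      -- union can run over a full box.
      q.1 ≠ q.2.1 ∧ ((n - q.2.2 : ℕ) : ℝ) ≤ θ * n} with hE
  have key : ∀ σ : ℝ, |σ| = 1 → ∀ᵐ ω ∂P, ∀ᶠ n : ℕ in atTop, ω ∉ ⋃ q ∈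
      Finset.range ⌈c * (n : ℝ) ^ τ⌉₊ ×ˢ Finset.range ⌈c * (n : ℝ) ^ τ⌉₊ ×ˢ Finset.range n,
      E σ n q := by
    intro σ hσ
    refine ae_eventually_notMem_of_le_rpow (c := (c + 1) ^ 2) (t := 3) (by norm_num) ?_
    filter_upwards [eventually_gt_atTop 0,
      h.eventually_pair_tail ht hσ δ hK0.le (min_le_left _ _ : θ ≤ 1) one_pos] with n hn htail
    have hn' : (0 : ℝ) < n := by exact_mod_cast hn
    have hn1 : (1 : ℝ) ≤ n := by exact_mod_cast hn
    have hx : ∀ q ∈ Finset.range ⌈c * (n : ℝ) ^ τ⌉₊ ×ˢ Finset.range ⌈c * (n : ℝ) ^ τ⌉₊ ×ˢ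
        Finset.range n, P.real (E σ n q) ≤ (n : ℝ) ^ (-(2 * τ + 4)) := by
      rintro ⟨i, j, N⟩ -
      by_cases hq : i ≠ j ∧ ((n - N : ℕ) : ℝ) ≤ θ * n
      · refine (measureReal_mono ?_).trans
          ((htail i j hq.1 (Finset.Ico N n) (by simpa using hq.2)).trans ?_)
        · intro ω hω; exact ⟨hω.1, hω.2.1⟩
        · refine Real.rpow_le_rpow_of_exponent_le hn1 ?_
          have : K * δ = 2 * τ + 6 := by rw [hK]; field_simp
          linarith
      · have : E σ n (i, j, N) = ∅ := by
          ext ω; simp only [Set.mem_empty_iff_false, iff_false]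
          intro hω; exact hq hω.2.2
        rw [this, measureReal_empty]; positivity
    refine (measureReal_biUnion_le_card_mul _ hx).trans ?_
    simp only [Finset.card_product, Finset.card_range, Nat.cast_mul]
    have hI := natCeil_mul_rpow_le hc hτ.le hn
    calc (⌈c * (n : ℝ) ^ τ⌉₊ : ℝ) * (⌈c * (n : ℝ) ^ τ⌉₊ * n) * (n : ℝ) ^ (-(2 * τ + 4))
        ≤ (c + 1) * (n : ℝ) ^ τ * ((c + 1) * (n : ℝ) ^ τ * n) * (n : ℝ) ^ (-(2 * τ + 4)) := by
          gcongr
      _ = (c + 1) ^ 2 * ((n : ℝ) ^ τ * (n : ℝ) ^ τ * (n : ℝ) ^ (1 : ℝ) *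
            (n : ℝ) ^ (-(2 * τ + 4))) := by
          rw [Real.rpow_one]; ring
      _ = _ := by
          rw [← Real.rpow_add hn', ← Real.rpow_add hn', ← Real.rpow_add hn']; congr 2; ring
  filter_upwards [key 1 (by simp), key (-1) (by simp), ae_eventually_abs_le ht hc]
    with ω h1 h2 h3
  filter_upwards [h1, h2, h3, tendsto_log_natCast_atTop.eventually_gt_atTop 0,
    eventually_gt_atTop 0] with n h1 h2 h3 hL hn i j hij hi hj N hN hNθ
  have hn' : (0 : ℝ) < n := by exact_mod_cast hn
  rcases hN.eq_or_lt with rfl | hlt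
  · simp; positivity
  have hsub : centeredSqDist X m₂ i j n ω - centeredSqDist X m₂ i j N ω =
      ∑ k ∈ Finset.Ico N n, ((X i k ω - X j k ω) ^ 2 - 2 * m₂) :=
    (Finset.sum_Ico_eq_sub _ hN).symm
  have htr : ∀ k ∈ Finset.Ico N n, |X i k ω| ≤ (n : ℝ) ^ b ∧ |X j k ω| ≤ (n : ℝ) ^ b := by
    intro k hk
    have hk' := (Finset.mem_Ico.1 hk).2
    exact ⟨h3 i hi k hk', h3 j hj k hk'⟩
  have hmem : (i, j, N) ∈ Finset.range ⌈c * (n : ℝ) ^ τ⌉₊ ×ˢ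
      Finset.range ⌈c * (n : ℝ) ^ τ⌉₊ ×ˢ Finset.range n := by
    simp [Nat.lt_ceil, hi, hj, hlt]
  rw [hsub, abs_le]
  constructor
  · by_contra! hcon
    exact h2 (Set.mem_biUnion hmem ⟨by linarith, htr, hij, hNθ⟩)
  · by_contra! hcon
    exact h1 (Set.mem_biUnion hmem ⟨by linarith, htr, hij, hNθ⟩)

/-- Almost sure upper bound along polynomial subsequences. -/
theorem exists_ae_eventually_lt (h : IsIIDArray P X μ m₂ m₄) (ht : HasTailBound P X b τ D)
    (hm₂ : 0 < m₂) {y : ℝ} (hy0 : 0 ≤ y) (hy : 2 * τ < y ^ 2 / (2 * (2 * m₄ + 2 * m₂ ^ 2))) :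
    ∃ R₀ : ℕ, ∀ R ≥ R₀, ∀ c : ℝ, 0 ≤ c → ∀ᵐ ω ∂P, ∀ᶠ m : ℕ in atTop,
      ∀ i j : ℕ, i ≠ j → (i : ℝ) < c * ((m ^ R : ℕ) : ℝ) ^ τ →
      (j : ℝ) < c * ((m ^ R : ℕ) : ℝ) ^ τ →
      centeredSqDist X m₂ i j (m ^ R) ω < y * √((m ^ R : ℕ) * Real.log (m ^ R : ℕ)) := by
  have hτ := ht.pos
  have h4 := h.nonneg_m₄
  set V := 2 * m₄ + 2 * m₂ ^ 2 with hV
  have hV0 : 0 < V := by positivity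
  -- Half of the excess of the exponent over 2τ: the other half is lost to η. The union bound then
  -- gives n^(-γ), and Rγ ≥ 2 makes it summable along n = m^R.
  set γ := (y ^ 2 / (2 * V) - 2 * τ) / 2 with hγ
  have hγ0 : 0 < γ := by rw [hγ]; linarith
  obtain ⟨R₀, hR₀⟩ := exists_nat_gt (2 / γ)
  refine ⟨R₀ + 1, fun R hR c hc => ?_⟩
  have hRγ : 2 ≤ R * γ := by
    have : (R₀ : ℝ) ≤ R := by exact_mod_cast (by omega : R₀ ≤ R)
    rw [div_lt_iff₀ hγ0] at hR₀
    nlinarith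
  have hRpos : R ≠ 0 := by omega
  have hpow : Tendsto (fun m : ℕ => m ^ R) atTop atTop := tendsto_pow_atTop hRpos
  set E : ℕ → ℕ × ℕ → Set Ω := fun n q =>
    {ω | y * √(n * Real.log n) ≤ 1 * ∑ k ∈ Finset.range n,
        ((X q.1 k ω - X q.2 k ω) ^ 2 - 2 * m₂) ∧
      (∀ k ∈ Finset.range n, |X q.1 k ω| ≤ (n : ℝ) ^ b ∧ |X q.2 k ω| ≤ (n : ℝ) ^ b) ∧
      q.1 ≠ q.2} with hE
  have hprob : ∀ᶠ n : ℕ in atTop, P.real (⋃ q ∈ Finset.range ⌈c * (n : ℝ) ^ τ⌉₊ ×ˢ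
      Finset.range ⌈c * (n : ℝ) ^ τ⌉₊, E n q) ≤ (c + 1) ^ 2 * (n : ℝ) ^ (-γ) := by
    filter_upwards [eventually_gt_atTop 0,
      h.eventually_pair_tail ht (σ := 1) (by simp) y (by positivity : 0 ≤ y / V)
        (le_refl (1 : ℝ)) hγ0] with n hn htail
    have hn' : (0 : ℝ) < n := by exact_mod_cast hn
    have hx : ∀ q ∈ Finset.range ⌈c * (n : ℝ) ^ τ⌉₊ ×ˢ Finset.range ⌈c * (n : ℝ) ^ τ⌉₊,
        P.real (E n q) ≤ (n : ℝ) ^ (-(2 * τ + γ)) := by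
      rintro ⟨i, j⟩ -
      by_cases hq : i ≠ j
      · refine (measureReal_mono ?_).trans
          ((htail i j hq (Finset.range n) (by simp)).trans_eq ?_)
        · intro ω hω; exact ⟨hω.1, hω.2.1⟩
        · congr 1
          rw [← hV, hγ]
          field_simp
          ring
      · have : E n (i, j) = ∅ := by
          ext ω; simp only [Set.mem_empty_iff_false, iff_false]
          intro hω; exact hq hω.2.2
        rw [this, measureReal_empty]; positivity
    refine (measureReal_biUnion_le_card_mul _ hx).trans ?_
    simp only [Finset.card_product, Finset.card_range, Nat.cast_mul]
    have hI := natCeil_mul_rpow_le hc hτ.le hn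
    calc (⌈c * (n : ℝ) ^ τ⌉₊ : ℝ) * ⌈c * (n : ℝ) ^ τ⌉₊ * (n : ℝ) ^ (-(2 * τ + γ))
        ≤ (c + 1) * (n : ℝ) ^ τ * ((c + 1) * (n : ℝ) ^ τ) * (n : ℝ) ^ (-(2 * τ + γ)) := by
          gcongr
      _ = (c + 1) ^ 2 * ((n : ℝ) ^ τ * (n : ℝ) ^ τ * (n : ℝ) ^ (-(2 * τ + γ))) := by
          ring
      _ = _ := by
          rw [← Real.rpow_add hn', ← Real.rpow_add hn']; congr 2; ring
  have hbc := ae_eventually_notMem_of_le_rpow (P := P) (t := R * γ) (by linarith)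
    ((hpow.eventually hprob).mono fun m hm => hm.trans_eq (by
      rw [natCast_pow_rpow, mul_neg]))
  filter_upwards [hbc, ae_eventually_abs_le ht hc] with ω h1 h3
  filter_upwards [h1, hpow.eventually h3] with m h1 h3 i j hij hi hj
  by_contra! hcon
  have hmem : (i, j) ∈ Finset.range ⌈c * ((m ^ R : ℕ) : ℝ) ^ τ⌉₊ ×ˢ
      Finset.range ⌈c * ((m ^ R : ℕ) : ℝ) ^ τ⌉₊ := by
    simp only [Finset.mem_product, Finset.mem_range, Nat.lt_ceil]
    exact ⟨hi, hj⟩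
  refine h1 (Set.mem_biUnion hmem ⟨?_, fun k hk => ?_, hij⟩)
  · rw [one_mul]; exact hcon
  · have hk' := Finset.mem_range.1 hk
    exact ⟨h3 i hi k hk', h3 j hj k hk'⟩

end IsIIDArray

end Array

/-! ### The lower bound along R-th powers. -/

section Array

theorem eventually_const_mul_rpow_le {a b c d : ℝ} (hab : a < b) (hd : 0 < d) :
    ∀ᶠ n : ℕ in atTop, c * (n : ℝ) ^ a ≤ d * (n : ℝ) ^ b := by
  have h1 : Tendsto (fun n : ℕ => (n : ℝ) ^ (b - a)) atTop atTop :=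
    (tendsto_rpow_atTop (sub_pos.2 hab)).comp tendsto_natCast_atTop_atTop
  filter_upwards [h1.eventually_ge_atTop (c / d), eventually_gt_atTop 0] with n h1 hn
  have hn' : (0 : ℝ) < n := by exact_mod_cast hn
  rw [div_le_iff₀ hd] at h1
  calc c * (n : ℝ) ^ a ≤ ((n : ℝ) ^ (b - a) * d) * (n : ℝ) ^ a := by gcongr
    _ = d * ((n : ℝ) ^ (b - a) * (n : ℝ) ^ a) := by ring
    _ = _ := by rw [← Real.rpow_add hn', sub_add_cancel]

variable {Ω : Type*} [MeasurableSpace Ω]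

namespace IsIIDArray

variable {P : Measure Ω} [IsProbabilityMeasure P] {X : ℕ → ℕ → Ω → ℝ} {μ m₂ m₄ b τ D : ℝ}

/-- Moderate deviation lower bound for the squared distance of two rows. -/
theorem eventually_rpow_le_pair (h : IsIIDArray P X μ m₂ m₄) (hm₂ : 0 < m₂) {y β : ℝ}
    (hy : 0 ≤ y) (hβ : y ^ 2 / (2 * (2 * m₄ + 2 * m₂ ^ 2)) < β) :
    ∀ᶠ n : ℕ in atTop, ∀ i j, i ≠ j → (n : ℝ) ^ (-β) ≤
      P.real {ω | y * √(n * Real.log n) ≤ centeredSqDist X m₂ i j n ω} := by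
  have h4 := h.nonneg_m₄
  have hm := h.meas
  have hr : Function.Injective (![0, 1] : Fin 2 → ℕ) := by
    intro c c' hc
    fin_cases c <;> fin_cases c' <;> simp_all
  have hg : Measurable (fun x : Fin 2 → ℝ => (x 0 - x 1) ^ 2 - 2 * m₂) := by fun_prop
  have hs := h.sq_sub (i := 0) (j := 1) (by norm_num) 0
  have := eventually_rpow_le_measureReal_sum_range_ge_of_variance (P := P)
    (Y := fun k ω => (X 0 k ω - X 1 k ω) ^ 2 - 2 * m₂) (fun k => by fun_prop)
    ((h.iIndepFun_columns hr).comp (fun _ x => (x 0 - x 1) ^ 2 - 2 * m₂) fun _ => hg)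
    (fun k => (h.identDistrib_columns hr k 0).comp hg) hs.1 hs.2.1 (by positivity) hs.2.2 hy hβ
  filter_upwards [this] with n hn i j hij
  refine hn.trans_eq ?_
  have hid : IdentDistrib (fun ω => ((fun k => X 0 k ω), fun k => X 1 k ω))
      (fun ω => ((fun k => X i k ω), fun k => X j k ω)) P P :=
    (h.identDistrib_rows 0 i).prodMk (h.identDistrib_rows 1 j)
      (h.iIndepFun_rows.indepFun (by norm_num)) (h.iIndepFun_rows.indepFun hij)
  have hG : MeasurableSet {z : (ℕ → ℝ) × (ℕ → ℝ) | y * √(n * Real.log n) ≤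
      ∑ k ∈ Finset.range n, ((z.1 k - z.2 k) ^ 2 - 2 * m₂)} :=
    measurableSet_le measurable_const (by fun_prop)
  simp only [measureReal_def]
  congr 1
  exact hid.measure_mem_eq hG

/-- The event that the squared distance of the rows `i` and `j` is large while their entries
are truncated. -/
def largePair (X : ℕ → ℕ → Ω → ℝ) (m₂ b y : ℝ) (n i j : ℕ) : Set Ω :=
  {ω | y * √(n * Real.log n) ≤ centeredSqDist X m₂ i j n ω ∧
    (∀ k ∈ Finset.range n, |X i k ω| ≤ (n : ℝ) ^ b) ∧
    ∀ k ∈ Finset.range n, |X j k ω| ≤ (n : ℝ) ^ b}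

/-- A single set `G` serves all pairs of rows, which reduces measurability and independence of these
events to those of the rows. -/
theorem exists_largePair_eq_preimage (X : ℕ → ℕ → Ω → ℝ) (m₂ b y : ℝ) (n : ℕ) :
    ∃ G : Set ((ℕ → ℝ) × (ℕ → ℝ)), MeasurableSet G ∧ ∀ i j, largePair X m₂ b y n i j =
      (fun ω => ((fun k => X i k ω), fun k => X j k ω)) ⁻¹' G := by
  refine ⟨{z | y * √(n * Real.log n) ≤ ∑ k ∈ Finset.range n, ((z.1 k - z.2 k) ^ 2 - 2 * m₂)} ∩
    ((⋂ k ∈ Finset.range n, {z | |z.1 k| ≤ (n : ℝ) ^ b}) ∩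
      ⋂ k ∈ Finset.range n, {z | |z.2 k| ≤ (n : ℝ) ^ b}), ?_, fun i j => ?_⟩
  · exact (measurableSet_le measurable_const (by fun_prop)).inter
      ((Finset.measurableSet_biInter _ fun k _ => measurableSet_le (by fun_prop)
        measurable_const).inter
      (Finset.measurableSet_biInter _ fun k _ => measurableSet_le (by fun_prop) measurable_const))
  · ext ω
    simp [largePair, centeredSqDist]

theorem measurableSet_largePair (h : IsIIDArray P X μ m₂ m₄) (y : ℝ) (n i j : ℕ) :
    MeasurableSet (largePair X m₂ b y n i j) := by
  obtain ⟨G, hG, he⟩ := exists_largePair_eq_preimage X m₂ b y n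
  have hm := h.meas
  rw [he]
  exact (by fun_prop : Measurable fun ω => ((fun k => X i k ω), fun k => X j k ω)) hG

theorem largePair_inter (h : IsIIDArray P X μ m₂ m₄) (y : ℝ) (n : ℕ) {i j i' j' : ℕ}
    (h1 : i ≠ i') (h2 : i ≠ j') (h3 : j ≠ i') (h4 : j ≠ j') :
    P.real (largePair X m₂ b y n i j ∩ largePair X m₂ b y n i' j') =
      P.real (largePair X m₂ b y n i j) * P.real (largePair X m₂ b y n i' j') := by
  obtain ⟨G, hG, he⟩ := exists_largePair_eq_preimage X m₂ b y n
  have hm := h.meas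
  have hi := h.iIndepFun_rows.indepFun_prodMk_prodMk (fun i => by fun_prop) i j i' j' h1 h2 h3 h4
  have := hi.measure_inter_preimage_eq_mul G G hG hG
  rw [he, he]
  simp only [measureReal_def]
  rw [← ENNReal.toReal_mul]
  congr 1

/-- Truncating both rows loses at most 2D n^(-(2τ+1)), which is of smaller order than n^(-β) since β
< 2τ + 1. The truncation is part of the event because the bound for triples holds only there. -/
theorem eventually_le_largePair (h : IsIIDArray P X μ m₂ m₄) (ht : HasTailBound P X b τ D)
    (hm₂ : 0 < m₂) {y β : ℝ} (hy : 0 ≤ y) (hβ : y ^ 2 / (2 * (2 * m₄ + 2 * m₂ ^ 2)) < β)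
    (hβτ : β < 2 * τ + 1) :
    ∀ᶠ n : ℕ in atTop, ∀ i j, i ≠ j → 1 / 2 * (n : ℝ) ^ (-β) ≤
      P.real (largePair X m₂ b y n i j) := by
  filter_upwards [h.eventually_rpow_le_pair hm₂ hy hβ, eventually_gt_atTop 0,
    eventually_const_mul_rpow_le (a := -(2 * τ + 1)) (b := -β) (c := 2 * D) (d := 1 / 2)
      (by linarith) (by norm_num)] with n hn hn0 hD i j hij
  have hn' : (0 : ℝ) < n := by exact_mod_cast hn0
  have hU : ∀ l, P.real (⋃ k ∈ Finset.range n, {ω | (n : ℝ) ^ b < |X l k ω|}) ≤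
      D * (n : ℝ) ^ (-(2 * τ + 1)) := fun l =>
    (measureReal_biUnion_le_card_mul _ fun k _ => ht.le l k n hn0).trans_eq (by
      rw [Finset.card_range, show -(2 * τ + 1) = -(2 * τ + 2) + 1 by ring, Real.rpow_add hn',
        Real.rpow_one]; ring)
  have hsub : {ω | y * √(n * Real.log n) ≤ centeredSqDist X m₂ i j n ω} ⊆
      largePair X m₂ b y n i j ∪ ((⋃ k ∈ Finset.range n, {ω | (n : ℝ) ^ b < |X i k ω|}) ∪
        ⋃ k ∈ Finset.range n, {ω | (n : ℝ) ^ b < |X j k ω|}) := by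
    intro ω hω
    by_contra hcon
    simp only [Set.mem_union, not_or, Set.mem_iUnion, Set.mem_ofPred_eq, not_exists, not_lt]
      at hcon
    exact hcon.1 ⟨hω, hcon.2.1, hcon.2.2⟩
  have h1 := (measureReal_mono hsub (μ := P)).trans ((measureReal_union_le _ _).trans
    (add_le_add le_rfl (measureReal_union_le _ _)))
  have h2 := hn i j hij
  have h3 := hU i
  have h4 := hU j
  linarith

/-- Almost sure lower bound along polynomial subsequences. -/
theorem exists_ae_eventually_ge (h : IsIIDArray P X μ m₂ m₄) (ht : HasTailBound P X b τ D)
    (hm₂ : 0 < m₂) (hκ : m₄ < 5 * m₂ ^ 2) {y : ℝ} (hy0 : 0 ≤ y)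
    (hy : y ^ 2 / (2 * (2 * m₄ + 2 * m₂ ^ 2)) < 2 * τ) :
    ∃ R₀ : ℕ, ∀ R ≥ R₀, ∀ c : ℝ, 0 < c → ∀ᵐ ω ∂P, ∀ᶠ m : ℕ in atTop,
      ∃ i j : ℕ, i < j ∧ (j : ℝ) < c * ((m ^ R : ℕ) : ℝ) ^ τ ∧
      y * √((m ^ R : ℕ) * Real.log (m ^ R : ℕ)) ≤ centeredSqDist X m₂ i j (m ^ R) ω := by
  have hτ := ht.pos
  have h4 := h.nonneg_m₄
  set V := 2 * m₄ + 2 * m₂ ^ 2 with hV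
  have hV0 : 0 < V := by positivity
  set U := 3 * m₄ + m₂ ^ 2 with hU
  have hU0 : 0 < U := by positivity
  -- The exponent of the dependent pairs, and the only use of the fourth moment condition: `m₄` <
  -- 5`m₂`² gives 2(U - V)/U ≤ 1/2, while y²/(2V) < 2τ.
  have hgap : -τ - y ^ 2 / U + y ^ 2 / V < 0 := by
    have e : -τ - y ^ 2 / U + y ^ 2 / V = -τ + (y ^ 2 / (2 * V)) * (2 * (U - V) / U) := by
      field_simp
      ring
    have h1 : 2 * (U - V) / U ≤ 1 / 2 := by
      rw [div_le_iff₀ hU0]; rw [hU, hV]; linarith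
    have h2 : 0 ≤ y ^ 2 / (2 * V) := by positivity
    rw [e]
    nlinarith
  -- The two inequalities make both terms of the second moment bound O(n^(-η)), once η has been
  -- spent in β and in the triple bound.
  obtain ⟨η, hη0, hη1, hη2⟩ : ∃ η : ℝ, 0 < η ∧ y ^ 2 / (2 * V) + 2 * η ≤ 2 * τ ∧
      -τ - y ^ 2 / U + y ^ 2 / V + 4 * η ≤ 0 := by
    refine ⟨min ((2 * τ - y ^ 2 / (2 * V)) / 2) (-(-τ - y ^ 2 / U + y ^ 2 / V) / 4), ?_, ?_, ?_⟩
    · exact lt_min (by linarith) (by linarith)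
    · have := min_le_left ((2 * τ - y ^ 2 / (2 * V)) / 2) (-(-τ - y ^ 2 / U + y ^ 2 / V) / 4)
      linarith
    · have := min_le_right ((2 * τ - y ^ 2 / (2 * V)) / 2) (-(-τ - y ^ 2 / U + y ^ 2 / V) / 4)
      linarith
  set β := y ^ 2 / (2 * V) + η with hβ
  have hyV : y ^ 2 / V = 2 * (y ^ 2 / (2 * V)) := by field_simp
  obtain ⟨R₀, hR₀⟩ := exists_nat_gt (2 / η)
  refine ⟨R₀ + 1, fun R hR c hc => ?_⟩
  have hRη : 2 ≤ R * η := by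
    have : (R₀ : ℝ) ≤ R := by exact_mod_cast (by omega : R₀ ≤ R)
    rw [div_lt_iff₀ hη0] at hR₀
    nlinarith
  have hRpos : R ≠ 0 := by omega
  have hpow : Tendsto (fun m : ℕ => m ^ R) atTop atTop := tendsto_pow_atTop hRpos
  -- Two disjoint index blocks of length g fit below c n^τ, so each cell of the grid is a pair of
  -- distinct rows.
  set g : ℕ → ℕ := fun n => ⌊c * (n : ℝ) ^ τ / 3⌋₊ with hg
  have hprob : ∀ᶠ n : ℕ in atTop, P.real {ω | ∀ i ∈ Finset.range (g n),
      ∀ j ∈ Finset.Ico (g n) (2 * g n), ω ∉ largePair X m₂ b y n i j} ≤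
        (72 / c ^ 2 + 48 / c) * (n : ℝ) ^ (-η) := by
    filter_upwards [eventually_gt_atTop 0, h.eventually_le_largePair ht hm₂ hy0
      (show y ^ 2 / (2 * V) < β by linarith) (by linarith),
      h.eventually_triple_tail ht hy0 hη0 hU0,
      eventually_const_mul_rpow_le (a := 0) (b := τ) (c := 6) hτ hc] with n hn hq hr hgn
    have hn' : (0 : ℝ) < n := by exact_mod_cast hn
    have hn1 : (1 : ℝ) ≤ n := by exact_mod_cast hn
    have hgge : c * (n : ℝ) ^ τ / 6 ≤ g n := by
      have := (Nat.lt_floor_add_one (c * (n : ℝ) ^ τ / 3)).le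
      rw [Real.rpow_zero, mul_one] at hgn
      have h' : (g n : ℝ) = (⌊c * (n : ℝ) ^ τ / 3⌋₊ : ℝ) := rfl
      linarith
    have hg0 : 0 < g n := by
      have : (0 : ℝ) < g n := lt_of_lt_of_le (by positivity) hgge
      exact_mod_cast this
    have hq0 : 0 < 1 / 2 * (n : ℝ) ^ (-β) := by positivity
    refine (measureReal_forall_notMem_le (fun i j => h.measurableSet_largePair y n i j) hg0
      (by simp) (by simp; omega) hq0 (r := (n : ℝ) ^ (-(y ^ 2 / U - η))) (by positivity)
      ?_ ?_ ?_ ?_).trans ?_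
    · intro i hi j hj
      simp only [Finset.mem_range, Finset.mem_Ico] at hi hj
      exact hq i j (by omega)
    · intro i hi j hj j' hj' hne
      simp only [Finset.mem_range, Finset.mem_Ico] at hi hj hj'
      refine (measureReal_mono fun ω hω => ?_).trans (hr i j j' (by omega) (by omega) hne)
      exact ⟨hω.1.1, hω.2.1, fun k hk => ⟨hω.1.2.1 k (Finset.mem_range.2 hk),
        hω.1.2.2 k (Finset.mem_range.2 hk), hω.2.2.2 k (Finset.mem_range.2 hk)⟩⟩
    · intro i hi i' hi' j hj hne
      simp only [Finset.mem_range, Finset.mem_Ico] at hi hi' hj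
      refine (measureReal_mono fun ω hω => ?_).trans (hr j i i' (by omega) (by omega) hne)
      have hsymm : ∀ i, centeredSqDist X m₂ j i n ω = centeredSqDist X m₂ i j n ω := fun i =>
        Finset.sum_congr rfl fun k _ => by ring
      refine ⟨?_, ?_, fun k hk => ⟨hω.1.2.2 k (Finset.mem_range.2 hk),
        hω.1.2.1 k (Finset.mem_range.2 hk), hω.2.2.1 k (Finset.mem_range.2 hk)⟩⟩
      · rw [hsymm]; exact hω.1.1
      · rw [hsymm]; exact hω.2.1
    · intro i hi i' hi' j hj j' hj' h1 h2
      simp only [Finset.mem_range, Finset.mem_Ico] at hi hi' hj hj'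
      exact h.largePair_inter y n h1 (by omega) (by omega) h2
    · have b1 : 1 / ((g n : ℝ) ^ 2 * (1 / 2 * (n : ℝ) ^ (-β))) ≤ 72 / c ^ 2 * (n : ℝ) ^ (-η) := by
        calc 1 / ((g n : ℝ) ^ 2 * (1 / 2 * (n : ℝ) ^ (-β)))
            ≤ 1 / ((c * (n : ℝ) ^ τ / 6) ^ 2 * (1 / 2 * (n : ℝ) ^ (-β))) := by gcongr
          _ = 72 / c ^ 2 * (n : ℝ) ^ (-(2 * τ) + β) := by
            have e : (n : ℝ) ^ (2 * τ) = ((n : ℝ) ^ τ) ^ 2 := by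
              rw [two_mul, Real.rpow_add hn', sq]
            rw [Real.rpow_add hn', Real.rpow_neg hn'.le, Real.rpow_neg hn'.le, e]
            field_simp
            norm_num
          _ ≤ _ := by
            gcongr
            linarith
      have b2 : 2 * (n : ℝ) ^ (-(y ^ 2 / U - η)) / (g n * (1 / 2 * (n : ℝ) ^ (-β)) ^ 2) ≤
          48 / c * (n : ℝ) ^ (-η) := by
        calc 2 * (n : ℝ) ^ (-(y ^ 2 / U - η)) / (g n * (1 / 2 * (n : ℝ) ^ (-β)) ^ 2)
            ≤ 2 * (n : ℝ) ^ (-(y ^ 2 / U - η)) /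
              ((c * (n : ℝ) ^ τ / 6) * (1 / 2 * (n : ℝ) ^ (-β)) ^ 2) := by gcongr
          _ = 48 / c * ((n : ℝ) ^ (-(y ^ 2 / U - η)) * ((n : ℝ) ^ (-τ) *
              ((n : ℝ) ^ β * (n : ℝ) ^ β))) := by
            rw [Real.rpow_neg hn'.le β, Real.rpow_neg hn'.le τ]
            field_simp
            norm_num
          _ = 48 / c * (n : ℝ) ^ (-(y ^ 2 / U - η) + (-τ + (β + β))) := by
            rw [← Real.rpow_add hn', ← Real.rpow_add hn', ← Real.rpow_add hn']
          _ ≤ _ := by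
            gcongr
            linarith
      rw [add_mul]
      exact add_le_add b1 b2
  have hbc := ae_eventually_notMem_of_le_rpow (P := P) (t := R * η) (by linarith)
    ((hpow.eventually hprob).mono fun m hm => hm.trans_eq (by
      rw [natCast_pow_rpow, mul_neg]))
  filter_upwards [hbc] with ω h1
  filter_upwards [h1, eventually_gt_atTop 0] with m h1 hm0
  simp only [not_forall, not_not] at h1
  obtain ⟨i, hi, j, hj, hω⟩ := h1
  simp only [Finset.mem_range, Finset.mem_Ico] at hi hj
  refine ⟨i, j, by omega, ?_, hω.1⟩
  have hN : (0 : ℝ) < ((m ^ R : ℕ) : ℝ) := by positivity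
  have h2 : (j : ℝ) < 2 * g (m ^ R) := by exact_mod_cast hj.2
  have h3 : (g (m ^ R) : ℝ) ≤ c * ((m ^ R : ℕ) : ℝ) ^ τ / 3 := Nat.floor_le (by positivity)
  have h4 : 0 < c * ((m ^ R : ℕ) : ℝ) ^ τ := by positivity
  linarith

end IsIIDArray

end Array

/-! ### Approximating n from below by R-th powers. -/

section PowersAndRoots

/-- The largest `m ≤ n` with `m ^ R ≤ n`. -/
def powFloor (R n : ℕ) : ℕ := Nat.findGreatest (fun m => m ^ R ≤ n) n

theorem powFloor_pow_le {R : ℕ} (hR : R ≠ 0) (n : ℕ) : powFloor R n ^ R ≤ n :=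
  Nat.findGreatest_spec (P := fun m => m ^ R ≤ n) (Nat.zero_le n) (by simp [hR])

theorem le_powFloor {R n m : ℕ} (hR : R ≠ 0) (h : m ^ R ≤ n) : m ≤ powFloor R n :=
  Nat.le_findGreatest ((Nat.le_self_pow hR m).trans h) h

theorem lt_powFloor_succ_pow {R : ℕ} (hR : R ≠ 0) (n : ℕ) : n < (powFloor R n + 1) ^ R := by
  by_contra! h
  have := le_powFloor hR h
  omega

theorem tendsto_powFloor {R : ℕ} (hR : R ≠ 0) : Tendsto (powFloor R) atTop atTop :=
  tendsto_atTop.2 fun b => by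
    filter_upwards [eventually_ge_atTop (b ^ R)] with n hn
    exact le_powFloor hR hn

theorem eventually_mul_le_powFloor_pow {R : ℕ} (hR : R ≠ 0) {ρ : ℝ} (hρ : ρ < 1) :
    ∀ᶠ n : ℕ in atTop, ρ * n ≤ ((powFloor R n ^ R : ℕ) : ℝ) := by
  have h1 : Tendsto (fun m : ℕ => ((m : ℝ) / (m + 1)) ^ R) atTop (𝓝 1) := by
    simpa using (tendsto_natCast_div_add_atTop (1 : ℝ)).pow R
  filter_upwards [(tendsto_powFloor hR).eventually (h1.eventually_const_le hρ)] with n hn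
  set m := powFloor R n
  have h2 : (n : ℝ) ≤ ((m : ℝ) + 1) ^ R := by exact_mod_cast (lt_powFloor_succ_pow hR n).le
  have h3 : (0 : ℝ) < ((m : ℝ) + 1) ^ R := by positivity
  rw [div_pow, le_div_iff₀ h3] at hn
  rcases le_or_gt ρ 0 with h0 | h0
  · have : ρ * n ≤ 0 := mul_nonpos_of_nonpos_of_nonneg h0 (Nat.cast_nonneg n)
    exact this.trans (Nat.cast_nonneg _)
  · push_cast
    exact (mul_le_mul_of_nonneg_left h2 h0.le).trans hn

theorem powFloor_bound {R : ℕ} (hR : R ≠ 0) {n : ℕ} (hn : 0 < n) :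
    n ≤ 2 ^ R * powFloor R n ^ R := by
  have h1 : 1 ≤ powFloor R n := le_powFloor hR (by rw [one_pow]; exact hn)
  refine (lt_powFloor_succ_pow hR n).le.trans ?_
  rw [← mul_pow]
  exact Nat.pow_le_pow_left (by omega) R

theorem sqrt_mul_log_mono {N n : ℕ} (h : N ≤ n) (hN : 0 < N) :
    √(N * Real.log N) ≤ √(n * Real.log n) := by
  have h1 : (1 : ℝ) ≤ N := by exact_mod_cast hN
  have h2 : (N : ℝ) ≤ n := by exact_mod_cast h
  have := Real.log_nonneg h1
  exact Real.sqrt_le_sqrt (mul_le_mul h2 (Real.log_le_log (by linarith) h2) this (by linarith))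

/-- For large n the constant log ρ is absorbed: log N ≥ log n + log ρ ≥ ρ log n. -/
theorem eventually_mul_sqrt_le {ρ : ℝ} (hρ0 : 0 < ρ) (hρ1 : ρ < 1) :
    ∀ᶠ n : ℕ in atTop, ∀ N : ℕ, ρ * n ≤ N → ρ * √(n * Real.log n) ≤ √(N * Real.log N) := by
  filter_upwards [tendsto_log_natCast_atTop.eventually_ge_atTop (-Real.log ρ / (1 - ρ)),
    eventually_gt_atTop 0, tendsto_log_natCast_atTop.eventually_ge_atTop 0] with n hn hn0 hL N hN
  have hn' : (0 : ℝ) < n := by exact_mod_cast hn0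
  have hN0 : 0 < ρ * (n : ℝ) := by positivity
  have hlog : ρ * Real.log n ≤ Real.log N := by
    have h1 := Real.log_le_log hN0 hN
    rw [Real.log_mul hρ0.ne' hn'.ne'] at h1
    rw [div_le_iff₀ (by linarith)] at hn
    linarith
  refine Real.le_sqrt_of_sq_le ?_
  rw [mul_pow, Real.sq_sqrt (by positivity)]
  calc ρ ^ 2 * (n * Real.log n) = (ρ * n) * (ρ * Real.log n) := by ring
    _ ≤ _ := mul_le_mul hN hlog (by positivity) (by positivity)

end PowersAndRoots

/-! ### From R-th powers to all n, and the maximum. -/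

section Array

variable {Ω : Type*} [MeasurableSpace Ω]

namespace IsIIDArray

variable {P : Measure Ω} [IsProbabilityMeasure P] {X : ℕ → ℕ → Ω → ℝ} {μ m₂ m₄ b τ D : ℝ}

theorem ae_eventually_pairs_le (h : IsIIDArray P X μ m₂ m₄) (ht : HasTailBound P X b τ D)
    (hm₂ : 0 < m₂) {y c : ℝ} (hc : 0 ≤ c) (hy : √(2 * τ * (2 * (2 * m₄ + 2 * m₂ ^ 2))) < y) :
    ∀ᵐ ω ∂P, ∀ᶠ n : ℕ in atTop, ∀ i j : ℕ, i ≠ j → (i : ℝ) < c * (n : ℝ) ^ τ →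
      (j : ℝ) < c * (n : ℝ) ^ τ → centeredSqDist X m₂ i j n ω ≤ y * √(n * Real.log n) := by
  have hτ := ht.pos
  have h4 := h.nonneg_m₄
  set V := 2 * m₄ + 2 * m₂ ^ 2 with hV
  have hV0 : 0 < V := by positivity
  obtain ⟨y', hy1, hy2⟩ := exists_between hy
  have hy'0 : 0 < y' := (Real.sqrt_nonneg _).trans_lt hy1
  have hy'V : 2 * τ < y' ^ 2 / (2 * V) := by
    rw [lt_div_iff₀ (by positivity)]
    exact (Real.sqrt_lt' hy'0).1 hy1
  obtain ⟨R₀, hR₀⟩ := h.exists_ae_eventually_lt ht hm₂ hy'0.le hy'V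
  set R := R₀ + 1 with hRdef
  have hR : R ≠ 0 := by omega
  obtain ⟨θ, hθ, hfl⟩ := h.ae_eventually_abs_sub_le ht hc (sub_pos.2 hy2)
  filter_upwards [hR₀ R (by omega) (c * (2 ^ R : ℝ) ^ τ) (by positivity), hfl] with ω h1 h2
  filter_upwards [(tendsto_powFloor hR).eventually h1, h2, eventually_gt_atTop 0,
    eventually_mul_le_powFloor_pow hR (show 1 - θ < 1 by linarith)]
    with n h1 h2 hn hθn i j hij hi hj
  set N := powFloor R n ^ R with hN
  have hNn : N ≤ n := powFloor_pow_le hR n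
  have hN0 : 0 < N := by
    have := powFloor_bound hR hn
    exact Nat.pos_of_ne_zero fun h0 => by rw [← hN, h0, mul_zero] at this; omega
  -- The subsequence bound was taken with an enlarged constant so that its index range at time N
  -- covers all rows in play at time n ≤ 2^R N.
  have hcN : c * (n : ℝ) ^ τ ≤ c * (2 ^ R : ℝ) ^ τ * (N : ℝ) ^ τ := by
    rw [mul_assoc, ← Real.mul_rpow (by positivity) (by positivity)]
    have : (n : ℝ) ≤ 2 ^ R * N := by exact_mod_cast powFloor_bound hR hn
    gcongr
  have a1 := (h1 i j hij (hi.trans_le hcN) (hj.trans_le hcN)).le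
  have a2 := h2 i j hij hi hj N hNn (by rw [Nat.cast_sub hNn]; linarith)
  have a3 := mul_le_mul_of_nonneg_left (sqrt_mul_log_mono hNn hN0) hy'0.le
  have a4 := (abs_le.1 a2).2
  linarith

theorem ae_eventually_exists_pair_ge (h : IsIIDArray P X μ m₂ m₄) (ht : HasTailBound P X b τ D)
    (hm₂ : 0 < m₂) (hκ : m₄ < 5 * m₂ ^ 2) {y c : ℝ} (hc : 0 < c)
    (hy : y < √(2 * τ * (2 * (2 * m₄ + 2 * m₂ ^ 2)))) :
    ∀ᵐ ω ∂P, ∀ᶠ n : ℕ in atTop, ∃ i j : ℕ, i < j ∧ (j : ℝ) < c * (n : ℝ) ^ τ ∧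
      y * √(n * Real.log n) ≤ centeredSqDist X m₂ i j n ω := by
  have hτ := ht.pos
  have h4 := h.nonneg_m₄
  set V := 2 * m₄ + 2 * m₂ ^ 2 with hV
  have hV0 : 0 < V := by positivity
  -- The maximum with 0 is taken because `y` may be negative, whereas the subsequence bound needs a
  -- nonnegative level.
  obtain ⟨y', hy1, hy2⟩ := exists_between (max_lt hy (Real.sqrt_pos.2 (by positivity)))
  have hy'0 : 0 < y' := (le_max_right _ _).trans_lt hy1
  have hyy' : y < y' := (le_max_left _ _).trans_lt hy1
  have hy'V : y' ^ 2 / (2 * V) < 2 * τ := by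
    rw [div_lt_iff₀ (by positivity)]
    exact (Real.lt_sqrt hy'0.le).1 hy2
  obtain ⟨ρ, hρ0, hρ1, hρy⟩ : ∃ ρ : ℝ, 0 < ρ ∧ ρ < 1 ∧ y < y' * ρ := by
    obtain ⟨ρ, h1, h2⟩ := exists_between (max_lt ((div_lt_one hy'0).2 hyy') one_pos)
    refine ⟨ρ, (le_max_right _ _).trans_lt h1, h2, ?_⟩
    have := (le_max_left _ _).trans_lt h1
    rw [div_lt_iff₀ hy'0] at this
    linarith
  obtain ⟨R₀, hR₀⟩ := h.exists_ae_eventually_ge ht hm₂ hκ hy'0.le hy'V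
  set R := R₀ + 1 with hRdef
  have hR : R ≠ 0 := by omega
  obtain ⟨θ, hθ, hfl⟩ := h.ae_eventually_abs_sub_le ht hc.le (sub_pos.2 hρy)
  filter_upwards [hR₀ R (by omega) c hc, hfl] with ω h1 h2
  filter_upwards [(tendsto_powFloor hR).eventually h1, h2,
    eventually_mul_le_powFloor_pow hR (show 1 - θ < 1 by linarith),
    eventually_mul_le_powFloor_pow hR hρ1, eventually_mul_sqrt_le hρ0 hρ1]
    with n h1 h2 hθn hρn hsq
  set N := powFloor R n ^ R with hN
  have hNn : N ≤ n := powFloor_pow_le hR n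
  obtain ⟨i, j, hij, hj, hge⟩ := h1
  have hcN : c * (N : ℝ) ^ τ ≤ c * (n : ℝ) ^ τ := by
    have : (N : ℝ) ≤ n := by exact_mod_cast hNn
    gcongr
  have hj' := hj.trans_le hcN
  have hi' : (i : ℝ) < c * (n : ℝ) ^ τ := lt_trans (by exact_mod_cast hij) hj'
  refine ⟨i, j, hij, hj', ?_⟩
  have a2 := h2 i j hij.ne hi' hj' N hNn (by rw [Nat.cast_sub hNn]; linarith)
  have a3 := mul_le_mul_of_nonneg_left (hsq N hρn) hy'0.le
  have a4 := (abs_le.1 a2).1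
  linarith

end IsIIDArray

theorem norm_arrayRow_sub_sq (x : ℕ → ℕ → ℝ) (n i j : ℕ) :
    ‖arrayRow x n i - arrayRow x n j‖ ^ 2 = ∑ k ∈ Finset.range n, (x i k - x j k) ^ 2 := by
  rw [EuclideanSpace.real_norm_sq_eq, Finset.sum_range]
  simp [arrayRow]

theorem norm_arrayRow_sub_sq_eq (X : ℕ → ℕ → Ω → ℝ) (m₂ : ℝ) (n i j : ℕ) (ω : Ω) :
    ‖arrayRow (fun i k => X i k ω) n i - arrayRow (fun i k => X i k ω) n j‖ ^ 2 =
      2 * n * m₂ + centeredSqDist X m₂ i j n ω := by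
  rw [norm_arrayRow_sub_sq, centeredSqDist, Finset.sum_sub_distrib]
  simp; ring

theorem maxInterpointDist_sq_le {x : ℕ → ℕ → ℝ} {p n : ℕ} {u : ℝ} (hu : 0 ≤ u)
    (h : ∀ i j : ℕ, i < j → j < p → ‖arrayRow x n i - arrayRow x n j‖ ^ 2 ≤ u) :
    maxInterpointDist x p n ^ 2 ≤ u := by
  -- For p < 2 the supremum is over the empty set and equals 0, which √u ≥ 0 covers.
  have h1 : maxInterpointDist x p n ≤ √u :=
    Real.iSup_le (fun q => Real.le_sqrt_of_sq_le (h _ _ q.2 q.1.2.2)) (Real.sqrt_nonneg _)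
  have h0 : 0 ≤ maxInterpointDist x p n := Real.iSup_nonneg fun q => norm_nonneg _
  exact (Real.le_sqrt h0 hu).1 h1

theorem le_maxInterpointDist_sq {x : ℕ → ℕ → ℝ} {p n i j : ℕ} (hij : i < j) (hj : j < p) :
    ‖arrayRow x n i - arrayRow x n j‖ ^ 2 ≤ maxInterpointDist x p n ^ 2 := by
  refine pow_le_pow_left₀ (norm_nonneg _) ?_ 2
  exact le_ciSup (f := fun q : {q : Fin p × Fin p // q.1 < q.2} =>
    ‖arrayRow x n q.1.1 - arrayRow x n q.1.2‖) (Set.finite_range _).bddAbove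
    ⟨(⟨i, hij.trans hj⟩, ⟨j, hj⟩), hij⟩

theorem tendsto_log_div_log {p : ℕ → ℕ} {τ c₁ c₂ : ℝ} (hc₁ : 0 < c₁)
    (hp : ∀ n : ℕ, 1 ≤ n → c₁ * (n : ℝ) ^ τ ≤ p n ∧ (p n : ℝ) ≤ c₂ * (n : ℝ) ^ τ) :
    Tendsto (fun n : ℕ => Real.log (p n) / Real.log n) atTop (𝓝 τ) := by
  have hlim : ∀ c : ℝ, Tendsto (fun n : ℕ => Real.log c / Real.log n + τ) atTop (𝓝 τ) := by
    intro c
    simpa using (tendsto_log_natCast_atTop.const_div_atTop (Real.log c)).add_const τ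
  have hc₂ : 0 < c₂ := by
    have := hp 1 le_rfl
    simp at this
    linarith
  have e : ∀ c : ℝ, 0 < c → ∀ n : ℕ, 0 < n → 0 < Real.log n →
      Real.log (c * (n : ℝ) ^ τ) / Real.log n = Real.log c / Real.log n + τ := by
    intro c hc n hn hL
    have hn' : (0 : ℝ) < n := by exact_mod_cast hn
    rw [Real.log_mul hc.ne' (Real.rpow_pos_of_pos hn' _).ne', Real.log_rpow hn']
    field_simp
  refine tendsto_of_tendsto_of_tendsto_of_le_of_le' (hlim c₁) (hlim c₂) ?_ ?_
  · filter_upwards [eventually_gt_atTop 0, tendsto_log_natCast_atTop.eventually_gt_atTop 0]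
      with n hn hL
    have hn' : (0 : ℝ) < n := by exact_mod_cast hn
    rw [← e c₁ hc₁ n hn hL]
    exact div_le_div_of_nonneg_right (Real.log_le_log (by positivity) (hp n hn).1) hL.le
  · filter_upwards [eventually_gt_atTop 0, tendsto_log_natCast_atTop.eventually_gt_atTop 0]
      with n hn hL
    have hn' : (0 : ℝ) < n := by exact_mod_cast hn
    have : 0 < (p n : ℝ) := lt_of_lt_of_le (by positivity) (hp n hn).1
    rw [← e c₂ hc₂ n hn hL]
    exact div_le_div_of_nonneg_right (Real.log_le_log this (hp n hn).2) hL.le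

theorem IsIIDArray.ae_tendsto_maxInterpointDist {P : Measure Ω} [IsProbabilityMeasure P]
    {X : ℕ → ℕ → Ω → ℝ} {μ m₂ m₄ b τ D : ℝ} (h : IsIIDArray P X μ m₂ m₄)
    (ht : HasTailBound P X b τ D) (hm₂ : 0 < m₂) (hκ : m₄ < 5 * m₂ ^ 2)
    {p : ℕ → ℕ} {c₁ c₂ : ℝ} (hc₁ : 0 < c₁)
    (hp : ∀ n : ℕ, 1 ≤ n → c₁ * (n : ℝ) ^ τ ≤ p n ∧ (p n : ℝ) ≤ c₂ * (n : ℝ) ^ τ) :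
    ∀ᵐ ω ∂P, Tendsto (fun n : ℕ =>
      (maxInterpointDist (fun i k => X i k ω) (p n) n ^ 2 - 2 * n * m₂) / √(n * Real.log n))
      atTop (𝓝 √(2 * τ * (2 * (2 * m₄ + 2 * m₂ ^ 2)))) := by
  set L := √(2 * τ * (2 * (2 * m₄ + 2 * m₂ ^ 2))) with hL
  have hc₂ : 0 ≤ c₂ := by
    have := hp 1 le_rfl
    simp at this
    linarith
  -- Countably many levels on either side of the limit, so that one null set serves them all.
  obtain ⟨u, -, hu, hulim⟩ := exists_seq_strictAnti_tendsto L
  obtain ⟨l, -, hl, hllim⟩ := exists_seq_strictMono_tendsto L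
  have hup := ae_all_iff.2 fun k => h.ae_eventually_pairs_le ht hm₂ hc₂ (hu k)
  have hlo := ae_all_iff.2 fun k => h.ae_eventually_exists_pair_ge ht hm₂ hκ hc₁ (hl k)
  filter_upwards [hup, hlo] with ω hup hlo
  have hpos : ∀ᶠ n : ℕ in atTop, 0 < √(n * Real.log n) := by
    filter_upwards [eventually_gt_atTop 0, tendsto_log_natCast_atTop.eventually_gt_atTop 0]
      with n hn hL
    have hn' : (0 : ℝ) < n := by exact_mod_cast hn
    exact Real.sqrt_pos.2 (by positivity)
  refine tendsto_order.2 ⟨fun a ha => ?_, fun a ha => ?_⟩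
  · obtain ⟨k, hk⟩ := (hllim.eventually_const_lt ha).exists
    filter_upwards [hlo k, hpos, eventually_ge_atTop 1] with n hn hpos hn1
    obtain ⟨i, j, hij, hj, hge⟩ := hn
    have hjp : j < p n := by
      have := hj.trans_le (hp n hn1).1
      exact_mod_cast this
    have h1 := le_maxInterpointDist_sq (x := fun i k => X i k ω) (n := n) hij hjp
    rw [norm_arrayRow_sub_sq_eq X m₂] at h1
    refine hk.trans_le ((le_div_iff₀ hpos).2 ?_)
    linarith
  · obtain ⟨k, hk⟩ := (hulim.eventually_lt_const ha).exists
    filter_upwards [hup k, hpos, eventually_ge_atTop 1] with n hn hpos hn1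
    have huk : 0 ≤ u k := (Real.sqrt_nonneg _).trans (hu k).le
    have h1 : maxInterpointDist (fun i k => X i k ω) (p n) n ^ 2 ≤
        2 * n * m₂ + u k * √(n * Real.log n) := by
      refine maxInterpointDist_sq_le (by positivity) fun i j hij hj => ?_
      rw [norm_arrayRow_sub_sq_eq X m₂]
      have hjc : (j : ℝ) < c₂ * (n : ℝ) ^ τ :=
        lt_of_lt_of_le (by exact_mod_cast hj) (hp n hn1).2
      have hic : (i : ℝ) < c₂ * (n : ℝ) ^ τ := lt_trans (by exact_mod_cast hij) hjc
      linarith [hn i j hij.ne hic hjc]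
    refine lt_of_le_of_lt ((div_le_iff₀ hpos).2 ?_) hk
    linarith

end Array

/-! ### The fourth moment and the final normalisation. -/

theorem integrable_sub_const_pow_four {Ω : Type*} [MeasurableSpace Ω] {P : Measure Ω}
    [IsProbabilityMeasure P] {U : Ω → ℝ} (hU : Measurable U) {q : ℝ} (hq : 4 ≤ q)
    (h : Integrable (fun ω => |U ω| ^ q) P) (μ : ℝ) : Integrable (fun ω => (U ω - μ) ^ 4) P := by
  have h4 : Integrable (fun ω => |U ω| ^ 4) P := by
    refine Integrable.mono' ((integrable_const 1).add h) (by fun_prop) (ae_of_all _ fun ω => ?_)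
    simp only [norm_pow, Real.norm_eq_abs, abs_abs, Pi.add_apply]
    rcases le_total |U ω| 1 with h | h
    · have := pow_le_one₀ (n := 4) (abs_nonneg _) h
      have : 0 ≤ |U ω| ^ q := by positivity
      linarith
    · have := Real.rpow_le_rpow_of_exponent_le h hq
      rw [show (4 : ℝ) = ((4 : ℕ) : ℝ) by norm_num, Real.rpow_natCast] at this
      linarith
  refine Integrable.mono' ((h4.const_mul 8).add (integrable_const (8 * μ ^ 4))) (by fun_prop)
    (ae_of_all _ fun ω => ?_)
  have h5 : |U ω| ^ 4 = U ω ^ 4 := Even.pow_abs (by decide) _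
  simp only [Pi.add_apply, h5]
  rw [Real.norm_eq_abs, abs_of_nonneg (by positivity)]
  have e1 : (U ω - μ) ^ 2 ≤ 2 * (U ω ^ 2 + μ ^ 2) := by nlinarith [sq_nonneg (U ω + μ)]
  have e2 : ((U ω - μ) ^ 2) ^ 2 ≤ (2 * (U ω ^ 2 + μ ^ 2)) ^ 2 :=
    pow_le_pow_left₀ (sq_nonneg _) e1 2
  nlinarith [sq_nonneg (U ω ^ 2 - μ ^ 2)]

theorem theorem2p3 {Ω : Type*} [MeasurableSpace Ω] (P : Measure Ω) [IsProbabilityMeasure P]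
    -- an infinite array of i.i.d. real random variables with positive variance and mean `μ`
    (X : ℕ → ℕ → Ω → ℝ)
    (hmeas : ∀ i k, Measurable (X i k))
    (hindep : iIndepFun (fun q : ℕ × ℕ => X q.1 q.2) P)
    (hident : ∀ i k, IdentDistrib (X i k) (X 0 0) P P)
    (hvar : 0 < variance (X 0 0) P)
    (μ : ℝ) (hμ : ∫ ω, X 0 0 ω ∂P = μ)
    -- the polynomial regime
    (p : ℕ → ℕ) (τ c₁ c₂ : ℝ) (hτ : 0 < τ) (hc₁ : 0 < c₁)
    (hp : ∀ n : ℕ, 1 ≤ n → c₁ ≤ (p n : ℝ) / (n : ℝ) ^ τ ∧ (p n : ℝ) / (n : ℝ) ^ τ ≤ c₂)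
    -- the moment condition
    (ε : ℝ) (hε : 0 < ε)
    (hmom : Integrable (fun ω => |X 0 0 ω| ^ (8 * τ + 8 + ε)) P) :
    (corr P (fun ω => |X 0 0 ω - X 1 0 ω| ^ 2) (fun ω => |X 0 0 ω - X 2 0 ω| ^ 2) < 1 / 3 ↔
      ∫ ω, |X 0 0 ω - μ| ^ 4 ∂P < 5 * (∫ ω, |X 0 0 ω - μ| ^ 2 ∂P) ^ 2) ∧
    (corr P (fun ω => |X 0 0 ω - X 1 0 ω| ^ 2) (fun ω => |X 0 0 ω - X 2 0 ω| ^ 2) < 1 / 3 →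
      ∀ᵐ ω ∂P, Tendsto
        (fun n : ℕ =>
          ((maxInterpointDist (fun i k => X i k ω) (p n) n) ^ 2
              - 2 * (n : ℝ) * ∫ ω', |X 0 0 ω' - μ| ^ 2 ∂P) /
            Real.sqrt (2 * ((∫ ω', |X 0 0 ω' - μ| ^ 4 ∂P)
                + (∫ ω', |X 0 0 ω' - μ| ^ 2 ∂P) ^ 2) * (n : ℝ) * Real.log (p n)))
        atTop (𝓝 2)) := by
  have e2 : ∀ ω, |X 0 0 ω - μ| ^ 2 = (X 0 0 ω - μ) ^ 2 := fun ω => sq_abs _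
  have e4 : ∀ ω, |X 0 0 ω - μ| ^ 4 = (X 0 0 ω - μ) ^ 4 := fun ω => Even.pow_abs (by decide) _
  simp only [e2, e4]
  set m₂ := ∫ ω, (X 0 0 ω - μ) ^ 2 ∂P with hm₂def
  set m₄ := ∫ ω, (X 0 0 ω - μ) ^ 4 ∂P with hm₄def
  have hm₂ : 0 < m₂ := by
    rw [variance_eq_integral (hmeas 0 0).aemeasurable, hμ] at hvar
    exact hvar
  -- `variance` is 0 by default outside L², so a positive variance already forces square
  -- integrability.
  have hint : Integrable (X 0 0) P := by
    by_contra hcon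
    have := memLp_two_of_variance_ne_zero (hmeas 0 0).aestronglyMeasurable hvar.ne'
    exact hcon (this.integrable (by norm_num))
  have hX : IsIIDArray P X μ m₂ m₄ := by
    refine ⟨hmeas, hindep, hident, (hmeas 0 0).sub_const _,
      integrable_sub_const_pow_four (hmeas 0 0) (by linarith) hmom μ, ?_, rfl, rfl⟩
    rw [integral_sub hint (integrable_const _), hμ]
    simp
  have hm₄ := hX.nonneg_m₄
  have hiff : corr P (fun ω => |X 0 0 ω - X 1 0 ω| ^ 2) (fun ω => |X 0 0 ω - X 2 0 ω| ^ 2) < 1 / 3 ↔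
      m₄ < 5 * m₂ ^ 2 := by
    rw [hX.corr_sq_sub, div_lt_div_iff₀ (by positivity) (by norm_num)]
    constructor <;> intro h <;> linarith
  refine ⟨hiff, fun hcorr => ?_⟩
  have hp' : ∀ n : ℕ, 1 ≤ n → c₁ * (n : ℝ) ^ τ ≤ p n ∧ (p n : ℝ) ≤ c₂ * (n : ℝ) ^ τ := by
    intro n hn
    have hn' : (0 : ℝ) < n := by exact_mod_cast hn
    have hpos := Real.rpow_pos_of_pos hn' τ
    obtain ⟨h1, h2⟩ := hp n hn
    exact ⟨(le_div_iff₀ hpos).1 h1, (div_le_iff₀ hpos).1 h2⟩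
  have hratio := (tendsto_log_div_log hc₁ hp').sqrt
  filter_upwards [hX.ae_tendsto_maxInterpointDist (hX.hasTailBound hτ hε hmom) hm₂ (hiff.1 hcorr)
    hc₁ hp'] with ω hω
  have hV : 0 < 2 * (m₄ + m₂ ^ 2) := by positivity
  have hlim := hω.div (hratio.const_mul √(2 * (m₄ + m₂ ^ 2)))
    (mul_pos (Real.sqrt_pos.2 hV) (Real.sqrt_pos.2 hτ)).ne'
  have hval : √(2 * τ * (2 * (2 * m₄ + 2 * m₂ ^ 2))) / (√(2 * (m₄ + m₂ ^ 2)) * √τ) = 2 := by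
    rw [← Real.sqrt_mul hV.le, ← Real.sqrt_div' _ (by positivity),
      show 2 * τ * (2 * (2 * m₄ + 2 * m₂ ^ 2)) / (2 * (m₄ + m₂ ^ 2) * τ) = 2 ^ 2 by
        field_simp]
    exact Real.sqrt_sq (by norm_num)
  rw [hval] at hlim
  refine hlim.congr' ?_
  filter_upwards [eventually_gt_atTop 0, tendsto_log_natCast_atTop.eventually_gt_atTop 0]
    with n hn hL
  have hn' : (0 : ℝ) < n := by exact_mod_cast hn
  simp only [Pi.div_apply]
  rw [div_div]
  congr 1
  rw [← Real.sqrt_mul hV.le, ← Real.sqrt_mul (by positivity)]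
  congr 1
  field_simp
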